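/- Let $\lambda$ be a Young diagram with $n$ boxes and let $\rho^\lambda$ be the corresponding irreducible representation of $S_n$ over $\mathbb{C}$; write $\chi^\lambda(g)=\operatorname{Tr}\rho^\lambda(g)/\operatorname{Tr}\rho^\lambda(e)$. *Disjoint cumulants.* A partial permutation of $\{1,\dots,n\}$ is a pair $\alpha=(A,w)$ with $A\subseteq\{1,\dots,n\}$ and $w$ a permutation of $A$ (extended by the identity to an element of $S_n$). On the vector space spanned by partial permutations define the disjoint product $\bullet$ bilinearly by $(A,w)\bullet(B,v)=(A\cup B,wv)$ if $A\cap B=\emptyset$ and $(A,w)\bullet(B,v)=0$ otherwise; this is a commutative unital algebra. Let $\mathbb{E}$ be the linear functional on it with $\mathbb{E}(A,w)=\chi^\lambda(w)$. For $\pi\in S_l$ the normalized conjugacy class is $$\Sigma_\pi=\sum_{f}\bigl(f(\{1,\dots,l\}),\ f\circ\pi\circ f^{-1}\bigr),$$ the sum over all injective functions $f:\{1,\dots,l\}\to\{1,\dots,n\}$. The disjoint cumulants $k^\bullet$ with respect to $\rho^\lambda$ are the cumulants for the product $\bullet$ and the functional $\mathbb{E}$, i.e. they are determined by $$\mathbb{E}(X_1\bullet\cdots\bullet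 X_m)=\sum_{P}\ \prod_{B\in P}k^\bullet\bigl(X_i: i\in B\bigr)\qquad(m\ge 1),$$ where $P$ runs over all set partitions of $\{1,\dots,m\}$. *Colorings.* For a permutation $\sigma$ let $|\sigma|$ be the minimal number of factors needed to write $\sigma$ as a product of transpositions, and let $C(\sigma)$ be the set of its cycles (fixed points included). Let $N^\lambda(\sigma_1,\sigma_2)$ be the number of functions $h:C(\sigma_1)\sqcup C(\sigma_2)\to\{1,2,\dots\}$ such that $h(c_1)\le\lambda_{h(c_2)}$ for all $c_1\in C(\sigma_1)$, $c_2\in C(\sigma_2)$ with $c_1\cap c_2\ne\emptyset$ (where $\lambda_j$ is the length of the $j$-th row, and $\lambda_j=0$ if there is no such row). **Proposition.** Let $r\ge 1$, $l_1,\dots,l_r\ge 1$ and $\pi_1\in S_{l_1},\dots,\pi_r\in S_{l_r}$. Then $$k^{\bullet}(\Sigma_{\pi_1},\dots,\Sigma_{\pi_r})=\sum_{\substack{\sigma_1,\sigma_2\in S_{l_1+\cdots+l_r},\ \sigma_1\sigma_2=\pi_1\times\cdots\times\pi_r,\\ \langle\sigma_1,\sigma_2,\,S_{l_1}\times\cdots\times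 S_{l_r}\rangle\text{ is transitive}}}(-1)^{|\sigma_1|}\,N^\lambda(\sigma_1,\sigma_2).$$ Here $\{1,\dots,l_1+\cdots+l_r\}$ is identified with the disjoint union of the sets $\{1,\dots,l_i\}$, and the sum runs over all factorizations for which $\sigma_1$, $\sigma_2$ and $S_{l_1}\times\cdots\times S_{l_r}$ together generate a group that acts transitively on this set. -/

import Mathlib

/-! ### The irreducible representation attached to a Young diagram -/

/-- `σ` moves the entries of the tableau `T` within the rows.
In Mathlib's `YoungDiagram` the first coordinate of a box is its row, the second its column
(both numbered from `0`). -/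
def PreservesRows {n : ℕ} {lam : YoungDiagram} (T : Fin n ≃ lam.cells)
    (σ : Equiv.Perm (Fin n)) : Prop :=
  ∀ x, (T (σ x)).1.1 = (T x).1.1

/-- `σ` moves the entries of the tableau `T` within the columns. -/
def PreservesCols {n : ℕ} {lam : YoungDiagram} (T : Fin n ≃ lam.cells)
    (σ : Equiv.Perm (Fin n)) : Prop :=
  ∀ x, (T (σ x)).1.2 = (T x).1.2

open Classical in
/-- The row symmetrizer `a = ∑_{σ preserves the rows} σ`. -/
noncomputable def rowSymmetrizer {n : ℕ} {lam : YoungDiagram} (T : Fin n ≃ lam.cells) :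
    MonoidAlgebra ℂ (Equiv.Perm (Fin n)) :=
  ∑ σ with PreservesRows T σ, MonoidAlgebra.single σ 1

open Classical in
/-- The column antisymmetrizer `b = ∑_{σ preserves the columns} sgn(σ) σ`. -/
noncomputable def colAntisymmetrizer {n : ℕ} {lam : YoungDiagram} (T : Fin n ≃ lam.cells) :
    MonoidAlgebra ℂ (Equiv.Perm (Fin n)) :=
  ∑ σ with PreservesCols T σ, MonoidAlgebra.single σ ((Equiv.Perm.sign σ : ℤ) : ℂ)

/-- The Young symmetrizer `c = b a`. -/
noncomputable def youngSymmetrizer {n : ℕ} {lam : YoungDiagram} (T : Fin n ≃ lam.cells) :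
    MonoidAlgebra ℂ (Equiv.Perm (Fin n)) :=
  colAntisymmetrizer T * rowSymmetrizer T

/-- The space `V^λ = ℂ[S_n] c`. -/
noncomputable def youngModule {n : ℕ} {lam : YoungDiagram} (T : Fin n ≃ lam.cells) :
    Submodule ℂ (MonoidAlgebra ℂ (Equiv.Perm (Fin n))) :=
  LinearMap.range (LinearMap.mulRight ℂ (youngSymmetrizer T))

theorem mul_mem_youngModule {n : ℕ} {lam : YoungDiagram} (T : Fin n ≃ lam.cells)
    (y : MonoidAlgebra ℂ (Equiv.Perm (Fin n))) :
    ∀ x ∈ youngModule T, LinearMap.mulLeft ℂ y x ∈ youngModule T := by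
  rintro x ⟨z, rfl⟩
  exact ⟨y * z, by simp [mul_assoc]⟩

/-- The irreducible representation `ρ^λ` of `S_n`: the group acts on `ℂ[S_n] c` by left
multiplication. (Up to isomorphism it does not depend on the tableau `T`, that is, on the
numbering of the boxes.) -/
noncomputable def youngRep {n : ℕ} {lam : YoungDiagram} (T : Fin n ≃ lam.cells) :
    Representation ℂ (Equiv.Perm (Fin n)) (youngModule T) where
  toFun g := (LinearMap.mulLeft ℂ (MonoidAlgebra.single g 1)).restrict (mul_mem_youngModule T _)
  map_one' := by
    ext x
    simp [← MonoidAlgebra.one_def]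
  map_mul' g h := by
    ext1 x
    apply Subtype.ext
    simp [← mul_assoc, MonoidAlgebra.single_mul_single]

/-- The rescaled character `χ(g) = Tr ρ(g) / Tr ρ(e)`. -/
noncomputable def normalizedCharacter {G V : Type*} [Monoid G] [AddCommGroup V] [Module ℂ V]
    (ρ : Representation ℂ G V) (g : G) : ℂ :=
  LinearMap.trace ℂ V (ρ g) / LinearMap.trace ℂ V (ρ 1)

/-! ### Partial permutations and the disjoint product -/

/-- A partial permutation of `α`: a finite set (the support) and a permutation of that set,
recorded as a permutation of `α` which fixes every point outside of the support. The support may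
be bigger than the set of points that are moved. -/
@[ext]
structure PartialPermutation (α : Type*) where
  supp : Finset α
  perm : Equiv.Perm α
  fix : ∀ x, x ∉ supp → perm x = x

namespace PartialPermutation

variable {α : Type*} [DecidableEq α]

/-- The empty partial permutation. -/
def empty (α : Type*) : PartialPermutation α := ⟨∅, 1, fun _ _ => rfl⟩

/-- The product of partial permutations: union of supports, composition of permutations. -/
def comp (a b : PartialPermutation α) : PartialPermutation α where
  supp := a.supp ∪ b.supp
  perm := a.perm * b.perm
  fix x hx := by
    simp only [Finset.mem_union, not_or] at hx
    simp [b.fix x hx.2, a.fix x hx.1]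

theorem comp_comm {a b : PartialPermutation α} (h : Disjoint a.supp b.supp) :
    a.comp b = b.comp a := by
  ext1
  · exact Finset.union_comm _ _
  · refine Equiv.Perm.Disjoint.commute fun x => ?_
    by_cases hx : x ∈ a.supp
    · exact Or.inr (b.fix x (Finset.disjoint_left.1 h hx))
    · exact Or.inl (a.fix x hx)

theorem comp_assoc (a b c : PartialPermutation α) : (a.comp b).comp c = a.comp (b.comp c) := by
  ext1
  · exact Finset.union_assoc _ _ _
  · exact mul_assoc _ _ _

theorem empty_comp (a : PartialPermutation α) : (empty α).comp a = a := by
  ext1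
  · exact Finset.empty_union _
  · exact one_mul _

end PartialPermutation

/-- The vector space of formal linear combinations of partial permutations, to be equipped with the
disjoint product. -/
def DisjointAlgebra (α : Type*) : Type _ := PartialPermutation α →₀ ℂ

namespace DisjointAlgebra

noncomputable instance (α : Type*) : AddCommGroup (DisjointAlgebra α) :=
  inferInstanceAs (AddCommGroup (PartialPermutation α →₀ ℂ))

noncomputable instance (α : Type*) : Module ℂ (DisjointAlgebra α) :=
  inferInstanceAs (Module ℂ (PartialPermutation α →₀ ℂ))

/-- The basis vector given by a partial permutation. -/
noncomputable def of {α : Type*} (a : PartialPermutation α) : DisjointAlgebra α :=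
  Finsupp.single a 1

/-- Linear extension of a function on partial permutations. -/
noncomputable def lift {α M : Type*} [AddCommGroup M] [Module ℂ M]
    (f : PartialPermutation α → M) : DisjointAlgebra α →ₗ[ℂ] M :=
  Finsupp.linearCombination ℂ f

theorem lift_of {α M : Type*} [AddCommGroup M] [Module ℂ M]
    (f : PartialPermutation α → M) (a : PartialPermutation α) : lift f (of a) = f a := by
  exact (Finsupp.linearCombination_single ℂ 1 a).trans (one_smul ℂ (f a))

theorem hom_ext {α M : Type*} [AddCommGroup M] [Module ℂ M]
    {f g : DisjointAlgebra α →ₗ[ℂ] M} (h : ∀ a, f (of a) = g (of a)) : f = g := by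
  apply Finsupp.lhom_ext'
  intro a
  apply LinearMap.ext_ring
  exact h a

variable {α : Type*} [DecidableEq α]

/-- The disjoint product of two partial permutations: their product if the supports are disjoint,
and zero otherwise. -/
noncomputable def basisMul (a b : PartialPermutation α) : DisjointAlgebra α :=
  if Disjoint a.supp b.supp then of (a.comp b) else 0

/-- The disjoint product, extended bilinearly. -/
noncomputable def mulMap : DisjointAlgebra α →ₗ[ℂ] DisjointAlgebra α →ₗ[ℂ] DisjointAlgebra α :=
  lift fun a => lift fun b => basisMul a b

theorem mulMap_of_of (a b : PartialPermutation α) : mulMap (of a) (of b) = basisMul a b := by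
  simp [mulMap, lift_of]

theorem mulMap_comm (x y : DisjointAlgebra α) : mulMap x y = mulMap y x := by
  suffices h : (mulMap : DisjointAlgebra α →ₗ[ℂ] _) = mulMap.flip from
    congrArg (fun f : DisjointAlgebra α →ₗ[ℂ] DisjointAlgebra α →ₗ[ℂ] DisjointAlgebra α =>
      f x y) h
  refine hom_ext fun a => hom_ext fun b => ?_
  rw [LinearMap.flip_apply, mulMap_of_of, mulMap_of_of, basisMul, basisMul]
  by_cases h : Disjoint a.supp b.supp
  · rw [if_pos h, if_pos h.symm, PartialPermutation.comp_comm h]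
  · rw [if_neg h, if_neg fun h' => h h'.symm]

theorem mulMap_assoc (x y z : DisjointAlgebra α) :
    mulMap (mulMap x y) z = mulMap x (mulMap y z) := by
  have h₁ : ∀ a b c : PartialPermutation α,
      mulMap (mulMap (of a) (of b)) (of c) = mulMap (of a) (mulMap (of b) (of c)) := by
    intro a b c
    simp only [mulMap_of_of, basisMul]
    by_cases hab : Disjoint a.supp b.supp <;> by_cases hbc : Disjoint b.supp c.supp <;>
      by_cases hac : Disjoint a.supp c.supp <;>
      simp [hab, hbc, hac, mulMap_of_of, basisMul, PartialPermutation.comp,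
        Finset.disjoint_union_left, Finset.disjoint_union_right, Finset.union_assoc, mul_assoc]
  have h₂ : ∀ (a b : PartialPermutation α) (z : DisjointAlgebra α),
      mulMap (mulMap (of a) (of b)) z = mulMap (of a) (mulMap (of b) z) := fun a b z =>
    LinearMap.congr_fun (hom_ext (f := mulMap (mulMap (of a) (of b)))
      (g := mulMap (of a) ∘ₗ mulMap (of b)) fun c => h₁ a b c) z
  have h₃ : ∀ (a : PartialPermutation α) (y z : DisjointAlgebra α),
      mulMap (mulMap (of a) y) z = mulMap (of a) (mulMap y z) := fun a y z =>
    LinearMap.congr_fun (hom_ext (f := mulMap.flip z ∘ₗ mulMap (of a))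
      (g := mulMap (of a) ∘ₗ mulMap.flip z) fun b => h₂ a b z) y
  exact LinearMap.congr_fun (hom_ext (f := mulMap.flip z ∘ₗ mulMap.flip y)
    (g := mulMap.flip (mulMap y z)) fun a => h₃ a y z) x

theorem one_mulMap (x : DisjointAlgebra α) : mulMap (of (PartialPermutation.empty α)) x = x := by
  suffices h : mulMap (of (PartialPermutation.empty α)) = LinearMap.id from
    congrArg (fun f : DisjointAlgebra α →ₗ[ℂ] DisjointAlgebra α => f x) h
  refine hom_ext fun a => ?_
  rw [mulMap_of_of, basisMul, if_pos (by simp [PartialPermutation.empty]),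
    PartialPermutation.empty_comp, LinearMap.id_apply]

/-- The commutative algebra of partial permutations with the disjoint product. -/
noncomputable instance : CommRing (DisjointAlgebra α) where
  __ := (inferInstance : AddCommGroup (DisjointAlgebra α))
  mul x y := mulMap x y
  one := of (PartialPermutation.empty α)
  mul_assoc := mulMap_assoc
  mul_comm := mulMap_comm
  one_mul := one_mulMap
  mul_one x := (mulMap_comm _ _).trans (one_mulMap x)
  left_distrib x := map_add (mulMap x)
  right_distrib x y z := congrArg (fun f : DisjointAlgebra α →ₗ[ℂ] DisjointAlgebra α => f z)
    (map_add mulMap x y)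
  zero_mul z := congrArg (fun f : DisjointAlgebra α →ₗ[ℂ] DisjointAlgebra α => f z)
    (map_zero mulMap)
  mul_zero x := map_zero (mulMap x)

theorem of_mul_of (a b : PartialPermutation α) :
    of a * of b = if Disjoint a.supp b.supp then of (a.comp b) else 0 :=
  mulMap_of_of a b

end DisjointAlgebra

/-- The partial permutation obtained by placing `π ∈ S_l` on the image of an injective function
`f : {1, …, l} → α`. -/
def PartialPermutation.place {l : ℕ} {α : Type*} [DecidableEq α] (π : Equiv.Perm (Fin l))
    (f : Fin l ↪ α) : PartialPermutation α where
  supp := Finset.univ.map f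
  perm := π.viaFintypeEmbedding f
  fix x hx := Equiv.Perm.viaFintypeEmbedding_apply_notMem_range π f (by simpa using hx)

/-- The normalized conjugacy class `Σ_π`, `π ∈ S_l`, in the algebra of partial permutations of
`{1, …, n}`: the sum over all injective functions `f : {1, …, l} → {1, …, n}` of the permutation
`f ∘ π ∘ f⁻¹` of the set `f({1, …, l})`. -/
noncomputable def conjClassSum {l : ℕ} (n : ℕ) (π : Equiv.Perm (Fin l)) :
    DisjointAlgebra (Fin n) :=
  ∑ f : Fin l ↪ Fin n, DisjointAlgebra.of (PartialPermutation.place π f)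

/-- The expectation given by a representation `ρ` of `S_n`: forget the supports and take the
rescaled character. -/
noncomputable def charExpectation {n : ℕ} {V : Type*} [AddCommGroup V] [Module ℂ V]
    (ρ : Representation ℂ (Equiv.Perm (Fin n)) V) : DisjointAlgebra (Fin n) →ₗ[ℂ] ℂ :=
  DisjointAlgebra.lift fun a => normalizedCharacter ρ a.perm

/-! ### Cumulants -/

/-- The cumulants, with respect to a functional `E` on a commutative algebra, of the subfamilies
`(X i)_{i ∈ s}` of a family `X`. They are determined by the moment-cumulant formula
`E (∏_{i ∈ s} X i) = ∑_P ∏_{B ∈ P} k_B`, the sum running over all set partitions `P` of `s`; the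
recursion solves it for the term of the one-block partition `{s}`. -/
noncomputable def jointCumulant {A ι : Type*} [CommRing A] [Module ℂ A] [DecidableEq ι]
    (E : A →ₗ[ℂ] ℂ) (X : ι → A) (s : Finset ι) : ℂ :=
  E (∏ i ∈ s, X i) -
    ∑ P : {P : Finpartition s // s ∉ P.parts}, ∏ B ∈ P.1.parts.attach, jointCumulant E X B.1
termination_by s.card
decreasing_by
  refine Finset.card_lt_card (lt_of_le_of_ne (P.1.le B.2) fun h => P.2 ?_)
  have hB := B.2
  rwa [h] at hB

/-- The moment-cumulant formula. -/
theorem moment_eq_sum_jointCumulant {A ι : Type*} [CommRing A] [Module ℂ A] [DecidableEq ι]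
    (E : A →ₗ[ℂ] ℂ) (X : ι → A) (s : Finset ι) (hs : s.Nonempty) :
    E (∏ i ∈ s, X i) = ∑ P : Finpartition s, ∏ B ∈ P.parts, jointCumulant E X B := by
  classical
  have key : ∀ P : Finpartition s, s ∈ P.parts → P.parts = {s} := by
    intro P hP
    refine Finset.eq_singleton_iff_unique_mem.2 ⟨hP, fun B hB => ?_⟩
    by_contra hne
    have hd := P.disjoint hB hP hne
    obtain ⟨x, hx⟩ := P.nonempty_of_mem_parts hB
    exact Finset.disjoint_left.1 hd hx (P.le hB hx)
  let P₀ : Finpartition s := Finpartition.indiscrete hs.ne_empty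
  have h1 : ∑ P : {P : Finpartition s // ¬ s ∉ P.parts}, ∏ B ∈ P.1.parts, jointCumulant E X B
      = jointCumulant E X s := by
    let _ : Unique {P : Finpartition s // ¬ s ∉ P.parts} :=
      { default := ⟨P₀, by simp [P₀]⟩
        uniq := fun P => Subtype.ext (Finpartition.ext (by
          rw [key P.1 (not_not.1 P.2)]; simp [P₀])) }
    have hd : (default : {P : Finpartition s // ¬ s ∉ P.parts}).1.parts = {s} :=
      key _ (not_not.1 (default : {P : Finpartition s // ¬ s ∉ P.parts}).2)
    rw [Fintype.sum_unique, hd, Finset.prod_singleton]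
  rw [← Fintype.sum_subtype_add_sum_subtype (fun P : Finpartition s => s ∉ P.parts), h1,
    jointCumulant.eq_1 E X s]
  simp only [Finset.prod_attach _ (fun B => jointCumulant E X B)]
  ring

/-- The disjoint cumulant `k^•(Σ_{π_1}, …, Σ_{π_r})` with respect to a representation `ρ` of `S_n`:
the cumulant, for the disjoint product, of the normalized conjugacy classes. -/
noncomputable def disjointCumulant {n r : ℕ} {V : Type*} [AddCommGroup V] [Module ℂ V]
    (ρ : Representation ℂ (Equiv.Perm (Fin n)) V) (l : Fin r → ℕ)
    (π : (i : Fin r) → Equiv.Perm (Fin (l i))) : ℂ :=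
  jointCumulant (charExpectation ρ) (fun i => conjClassSum n (π i)) Finset.univ

/-! ### Colorings of cycles and transitive factorizations -/

/-- `|σ|`: the minimal number of factors needed to write `σ` as a product of transpositions. -/
noncomputable def reflectionLength {X : Type*} [DecidableEq X] (σ : Equiv.Perm X) : ℕ :=
  sInf {k | ∃ L : List (Equiv.Perm X), L.length = k ∧ (∀ τ ∈ L, τ.IsSwap) ∧ L.prod = σ}

/-- `C(σ)`: the set of cycles of `σ`, fixed points included. -/
abbrev Cycles {X : Type*} (σ : Equiv.Perm X) : Type _ :=
  Quotient (Equiv.Perm.SameCycle.setoid σ)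

/-- A coloring of the cycles of `σ₁` (by columns) and of the cycles of `σ₂` (by rows) is compatible
with `λ` if for intersecting cycles `c₁`, `c₂` the box in column `h(c₁)` and row `h(c₂)` belongs to
`λ`. -/
def Compatible {X : Type*} (lam : YoungDiagram) (σ₁ σ₂ : Equiv.Perm X)
    (h : Cycles σ₁ ⊕ Cycles σ₂ → ℕ) : Prop :=
  ∀ (c₁ : Cycles σ₁) (c₂ : Cycles σ₂),
    (∃ x : X, Quotient.mk _ x = c₁ ∧ Quotient.mk _ x = c₂) →
      (h (Sum.inr c₂), h (Sum.inl c₁)) ∈ lam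

/-- `N^λ(σ₁, σ₂)`: the number of compatible colorings. -/
noncomputable def colorings {X : Type*} (lam : YoungDiagram) (σ₁ σ₂ : Equiv.Perm X) : ℕ :=
  Nat.card {h : Cycles σ₁ ⊕ Cycles σ₂ → ℕ // Compatible lam σ₁ σ₂ h}

/-- `σ₁`, `σ₂` and `S_{l_1} × ⋯ × S_{l_r}` together act transitively on the disjoint union of the
sets `{1, …, l_i}`, which stands for `{1, …, l_1 + ⋯ + l_r}`. -/
def ActTransitively {r : ℕ} (l : Fin r → ℕ) (σ₁ σ₂ : Equiv.Perm (Σ i, Fin (l i))) : Prop :=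
  MulAction.IsPretransitive
    (Subgroup.closure ({σ₁, σ₂} ∪
      Set.range (Equiv.Perm.sigmaCongrRightHom fun i => Fin (l i))))
    (Σ i, Fin (l i))

/-! ### The Young symmetrizer is idempotent up to a scalar -/

/-! Every moment of the classes `Σ_π` is a signed count of triples `(σ₁, σ₂, f)`, where `σ₁ σ₂` is
the product of the `π i` and `f` sends points to boxes of `λ`, with column constant on the cycles of
`σ₁` and row constant on the cycles of `σ₂`. Such counts factor over connected components, so the
cumulants count the connected triples. For fixed `(σ₁, σ₂)` the functions `f` are exactly the
colorings counted by `N^λ`, and the sign of `σ₁` is `(-1)^|σ₁|`.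

The moments come from the Young symmetrizer `c = b a`. Since `c² = α c`, the trace of `x ↦ g x c` on
the group algebra is `α` times the trace of `ρ^λ(g)`. Computing it on the basis of group elements
gives the normalized character as the average of the coefficients of `c` over the conjugates of `g`
(`normalizedCharacter_youngRep`). Summed over all placements of `π` the averaging disappears, and
expanding `c` gives signed factorizations of `π` adapted to an injective `f`. Non-injective `f` may
be added for free, because their contributions cancel (`sum_sign_adapted_eq_zero`,
`charExpectation_classSum`).

The disjoint product of classes is the class of the product permutation on the disjoint union of the
blocks (`classSum_mul_classSum`), so the moment of a set `s` of blocks is `signedCount` of `s`.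
Cutting a triple at the component of a marked block gives `signedCount_eq_sum`. The cumulants are
the only solution of this recursion (`jointCumulant_eq_of_recursion`), hence equal
`connectedSignedCount`. Finally, connectedness is transitivity (`actTransitively_iff`). -/

theorem Finset.sum_range_card_le_sum_id (s : Finset ℕ) :
    ∑ i ∈ Finset.range s.card, i ≤ ∑ i ∈ s, i ∧
      (∑ i ∈ Finset.range s.card, i = ∑ i ∈ s, i → s = Finset.range s.card) := by
  set m := s.card with hm
  have hc : (s \ Finset.range m).card = (Finset.range m \ s).card :=
    Finset.card_sdiff_comm (by simp [hm])
  have h1 : ∑ i ∈ s, i = ∑ i ∈ s \ Finset.range m, i + ∑ i ∈ s ∩ Finset.range m, i := by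
    rw [add_comm, Finset.sum_inter_add_sum_sdiff]
  have h2 : ∑ i ∈ Finset.range m, i
      = ∑ i ∈ Finset.range m \ s, i + ∑ i ∈ s ∩ Finset.range m, i := by
    rw [add_comm, Finset.inter_comm, Finset.sum_inter_add_sum_sdiff]
  -- Elements of `s` outside the initial segment are at least `m`, the missing ones are less than
  -- `m`, and there are equally many of both. The `i + 1` in `h4` makes the comparison strict unless
  -- nothing is missing.
  have h3 : (s \ Finset.range m).card * m ≤ ∑ i ∈ s \ Finset.range m, i := by
    rw [← smul_eq_mul]
    refine Finset.card_nsmul_le_sum _ _ _ fun i hi => ?_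
    simpa using (Finset.mem_sdiff.1 hi).2
  have h4 : ∑ i ∈ Finset.range m \ s, (i + 1) ≤ (Finset.range m \ s).card * m := by
    rw [← smul_eq_mul]
    refine Finset.sum_le_card_nsmul _ _ _ fun i hi => ?_
    simpa using (Finset.mem_sdiff.1 hi).1
  rw [Finset.sum_add_distrib, Finset.sum_const, smul_eq_mul, mul_one] at h4
  rw [hc] at h3
  refine ⟨by omega, fun h => ?_⟩
  have h5 : (Finset.range m \ s).card = 0 := by omega
  refine (Finset.eq_of_subset_of_card_le ?_ (by simp [hm])).symm
  rwa [Finset.card_eq_zero, Finset.sdiff_eq_empty_iff_subset] at h5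

section Tableau

variable {n : ℕ} {lam : YoungDiagram} (T : Fin n ≃ lam.cells)

theorem image_row_filter_col (j : ℕ) :
    (Finset.univ.filter fun x => (T x).1.2 = j).image (fun x => (T x).1.1)
      = Finset.range (lam.colLen j) := by
  ext i
  simp only [Finset.mem_image, Finset.mem_filter, Finset.mem_univ, true_and, Finset.mem_range,
    ← YoungDiagram.mem_iff_lt_colLen]
  constructor
  · rintro ⟨x, rfl, rfl⟩
    exact (YoungDiagram.mem_cells _).1 (T x).2
  · intro h
    exact ⟨T.symm ⟨(i, j), (YoungDiagram.mem_cells _).2 h⟩, by simp⟩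

theorem tableau_ext {x y : Fin n} (h₁ : (T x).1.1 = (T y).1.1) (h₂ : (T x).1.2 = (T y).1.2) :
    x = y :=
  T.injective (Subtype.ext (Prod.ext h₁ h₂))

/-- Let `S j` be the set of rows of the entries that `g` sends to column `j`. By hypothesis these
rows are distinct, so `S j` has as many elements as column `j`. The sum of `S j` is therefore at
least that of the initial segment of this size, while the totals over all `j` agree. Hence every `S
j` is an initial segment, namely the set of rows that meet column `j`. -/
theorem row_col_mem_of_injective (g : Equiv.Perm (Fin n))
    (hg : ∀ x y, (T x).1.1 = (T y).1.1 → (T (g x)).1.2 = (T (g y)).1.2 → x = y) (x : Fin n) :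
    ((T x).1.1, (T (g x)).1.2) ∈ lam := by
  set S : ℕ → Finset ℕ := fun j =>
    (Finset.univ.filter fun x => (T (g x)).1.2 = j).image (fun x => (T x).1.1) with hS
  have hinj : ∀ j, Set.InjOn (fun x => (T x).1.1)
      (Finset.univ.filter fun x => (T (g x)).1.2 = j : Finset (Fin n)) := by
    intro j x hx y hy hxy
    simp only [Finset.coe_filter, Finset.mem_univ, true_and, Set.mem_ofPred_eq] at hx hy
    exact hg x y hxy (hx.trans hy.symm)
  have hinj' : ∀ j, Set.InjOn (fun x => (T x).1.1)
      (Finset.univ.filter fun x => (T x).1.2 = j : Finset (Fin n)) := by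
    intro j x hx y hy hxy
    simp only [Finset.coe_filter, Finset.mem_univ, true_and, Set.mem_ofPred_eq] at hx hy
    exact tableau_ext T hxy (hx.trans hy.symm)
  have hcard : ∀ j, (S j).card = lam.colLen j := by
    intro j
    rw [hS, Finset.card_image_of_injOn (hinj j), ← Finset.card_range (lam.colLen j),
      ← image_row_filter_col T j, Finset.card_image_of_injOn (hinj' j)]
    exact Finset.card_equiv g (by simp)
  have hsum : ∀ j, ∑ i ∈ S j, i = ∑ x with (T (g x)).1.2 = j, (T x).1.1 := fun j =>
    Finset.sum_image (hinj j)
  have hsum' : ∀ j, ∑ i ∈ Finset.range (lam.colLen j), i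
      = ∑ x with (T x).1.2 = j, (T x).1.1 := fun j => by
    rw [← image_row_filter_col T j, Finset.sum_image (hinj' j)]
  set J : Finset ℕ := Finset.univ.image fun x => (T x).1.2 with hJ
  -- Both sides are the sum of the row indices of all boxes, grouped by the column before and after
  -- applying `g`.
  have htot : ∑ j ∈ J, ∑ i ∈ Finset.range (lam.colLen j), i = ∑ j ∈ J, ∑ i ∈ S j, i := by
    simp only [hsum, hsum']
    rw [Finset.sum_fiberwise_of_maps_to (fun x _ => by simp [hJ]),
      Finset.sum_fiberwise_of_maps_to (fun x _ => by simp [hJ])]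
  have hle : ∀ j ∈ J, ∑ i ∈ Finset.range (lam.colLen j), i ≤ ∑ i ∈ S j, i := fun j _ => by
    rw [← hcard j]; exact (Finset.sum_range_card_le_sum_id (S j)).1
  have heq := (Finset.sum_eq_sum_iff_of_le hle).1 htot ((T (g x)).1.2) (by simp [hJ])
  rw [← hcard] at heq
  have := (Finset.sum_range_card_le_sum_id _).2 heq
  rw [hcard] at this
  rw [YoungDiagram.mem_iff_lt_colLen, ← Finset.mem_range, ← this]
  simp only [hS, Finset.mem_image, Finset.mem_filter, Finset.mem_univ, true_and]
  exact ⟨x, rfl, rfl⟩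

/-- The row permutation must send `x` to the entry in the row of `x` and the column of `g x`; that
this box lies in the diagram is `row_col_mem_of_injective`. -/
theorem exists_eq_col_mul_row (g : Equiv.Perm (Fin n))
    (hg : ∀ x y, (T x).1.1 = (T y).1.1 → (T (g x)).1.2 = (T (g y)).1.2 → x = y) :
    ∃ q p, PreservesCols T q ∧ PreservesRows T p ∧ g = q * p := by
  have hmem := row_col_mem_of_injective T g hg
  let p₀ : Fin n → Fin n := fun x =>
    T.symm ⟨((T x).1.1, (T (g x)).1.2), (YoungDiagram.mem_cells _).2 (hmem x)⟩
  have hp₀ : ∀ x, (T (p₀ x)).1 = ((T x).1.1, (T (g x)).1.2) := fun x => by simp [p₀]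
  have hinj : Function.Injective p₀ := by
    intro x y hxy
    have h := hp₀ x
    rw [hxy, hp₀ y, Prod.mk.injEq] at h
    exact hg x y h.1.symm h.2.symm
  let p : Equiv.Perm (Fin n) := Equiv.ofBijective p₀ (Finite.injective_iff_bijective.1 hinj)
  refine ⟨g * p⁻¹, p, fun x => ?_, fun x => ?_, by simp⟩
  · obtain ⟨y, rfl⟩ := p.surjective x
    have h : (g * p⁻¹) (p y) = g y := by simp
    rw [h]
    exact (congrArg Prod.snd (hp₀ y)).symm
  · exact (congrArg Prod.fst (hp₀ x) :)

theorem single_mul_rowSymmetrizer {p : Equiv.Perm (Fin n)} (hp : PreservesRows T p) :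
    MonoidAlgebra.single p 1 * rowSymmetrizer T = rowSymmetrizer T := by
  classical
  rw [rowSymmetrizer, Finset.mul_sum]
  simp only [MonoidAlgebra.single_mul_single, mul_one]
  refine Finset.sum_equiv (Equiv.mulLeft p) (fun σ => ?_) fun σ _ => rfl
  simp only [Finset.mem_filter, Finset.mem_univ, true_and]
  exact forall_congr' fun x => by simp [hp (σ x)]

theorem colAntisymmetrizer_mul_single {q : Equiv.Perm (Fin n)} (hq : PreservesCols T q) :
    colAntisymmetrizer T * MonoidAlgebra.single q 1
      = ((Equiv.Perm.sign q : ℤ) : ℂ) • colAntisymmetrizer T := by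
  classical
  rw [colAntisymmetrizer, Finset.sum_mul, Finset.smul_sum]
  simp only [MonoidAlgebra.single_mul_single, mul_one, MonoidAlgebra.smul_single, smul_eq_mul]
  refine Finset.sum_equiv (Equiv.mulRight q) (fun σ => ?_) fun σ _ => ?_
  · simp only [Finset.mem_filter, Finset.mem_univ, true_and]
    constructor
    · intro h x
      simp [h (q x), hq x]
    · intro h x
      have h1 := h (q⁻¹ x)
      have h2 := hq (q⁻¹ x)
      simp at h1 h2
      rw [h1, h2]
  · have : (((Equiv.Perm.sign q : ℤ) : ℂ)) * ((Equiv.Perm.sign q : ℤ) : ℂ) = 1 := by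
      rw [← Int.cast_mul]; simp
    simp only [Equiv.coe_mulRight, Equiv.Perm.sign_mul, Units.val_mul, Int.cast_mul]
    rw [mul_left_comm, this, mul_one]

/-- Either `g = q p` with `q` absorbed by `b` up to sign and `p` absorbed by `a`, or two entries
`x`, `y` of one row are sent to one column. In the second case `g (x y) = (g x g y) g`, where `a`
absorbs the first transposition and `b` turns the second into `-1`, so the product is its own
negative. -/
theorem colAntisymmetrizer_mul_single_mul_rowSymmetrizer (g : Equiv.Perm (Fin n)) :
    ∃ α : ℂ, colAntisymmetrizer T * MonoidAlgebra.single g 1 * rowSymmetrizer T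
      = α • youngSymmetrizer T := by
  by_cases hg : ∀ x y, (T x).1.1 = (T y).1.1 → (T (g x)).1.2 = (T (g y)).1.2 → x = y
  · obtain ⟨q, p, hq, hp, rfl⟩ := exists_eq_col_mul_row T g hg
    refine ⟨((Equiv.Perm.sign q : ℤ) : ℂ), ?_⟩
    have : (MonoidAlgebra.single (q * p) 1 : MonoidAlgebra ℂ (Equiv.Perm (Fin n)))
        = MonoidAlgebra.single q 1 * MonoidAlgebra.single p 1 := by
      rw [MonoidAlgebra.single_mul_single, one_mul]
    rw [this, ← mul_assoc, colAntisymmetrizer_mul_single T hq, mul_assoc,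
      single_mul_rowSymmetrizer T hp, smul_mul_assoc, youngSymmetrizer]
  · push Not at hg
    obtain ⟨x, y, hrow, hcol, hxy⟩ := hg
    refine ⟨0, ?_⟩
    have hp : PreservesRows T (Equiv.swap x y) := fun z => by
      by_cases hzx : z = x
      · simp [hzx, hrow]
      by_cases hzy : z = y
      · simp [hzy, hrow]
      rw [Equiv.swap_apply_of_ne_of_ne hzx hzy]
    have hq : PreservesCols T (Equiv.swap (g x) (g y)) := fun z => by
      by_cases hzx : z = g x
      · simp [hzx, hcol]
      by_cases hzy : z = g y
      · simp [hzy, hcol]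
      rw [Equiv.swap_apply_of_ne_of_ne hzx hzy]
    have hcomm : (MonoidAlgebra.single g 1 * MonoidAlgebra.single (Equiv.swap x y) 1 :
        MonoidAlgebra ℂ (Equiv.Perm (Fin n)))
        = MonoidAlgebra.single (Equiv.swap (g x) (g y)) 1 * MonoidAlgebra.single g 1 := by
      rw [MonoidAlgebra.single_mul_single, MonoidAlgebra.single_mul_single,
        Equiv.mul_swap_eq_swap_mul]
    have h : colAntisymmetrizer T * MonoidAlgebra.single g 1 * rowSymmetrizer T
        = -(colAntisymmetrizer T * MonoidAlgebra.single g 1 * rowSymmetrizer T) := by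
      conv_lhs => rw [← single_mul_rowSymmetrizer T hp]
      rw [← mul_assoc, mul_assoc (colAntisymmetrizer T), hcomm, ← mul_assoc,
        colAntisymmetrizer_mul_single T hq, Equiv.Perm.sign_swap (g.injective.ne hxy)]
      simp
    rw [zero_smul]
    have h2 : (2 : ℂ) • (colAntisymmetrizer T * MonoidAlgebra.single g 1 * rowSymmetrizer T) = 0 := by
      rw [two_smul]
      nth_rewrite 1 [h]
      exact neg_add_cancel _
    exact (smul_eq_zero.1 h2).resolve_left two_ne_zero

theorem youngSymmetrizer_mul_self :
    ∃ α : ℂ, youngSymmetrizer T * youngSymmetrizer T = α • youngSymmetrizer T := by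
  have key : ∀ y : MonoidAlgebra ℂ (Equiv.Perm (Fin n)),
      ∃ α : ℂ, colAntisymmetrizer T * y * rowSymmetrizer T = α • youngSymmetrizer T := by
    intro y
    induction y using MonoidAlgebra.induction_linear with
    | zero => exact ⟨0, by simp⟩
    | add f g hf hg =>
      obtain ⟨a, ha⟩ := hf
      obtain ⟨b, hb⟩ := hg
      exact ⟨a + b, by rw [mul_add, add_mul, ha, hb, add_smul]⟩
    | single g r =>
      obtain ⟨a, ha⟩ := colAntisymmetrizer_mul_single_mul_rowSymmetrizer T g
      refine ⟨r * a, ?_⟩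
      have : (MonoidAlgebra.single g r : MonoidAlgebra ℂ (Equiv.Perm (Fin n)))
          = r • MonoidAlgebra.single g 1 := by simp
      rw [this, mul_smul_comm, smul_mul_assoc, ha, smul_smul]
  obtain ⟨α, hα⟩ := key (rowSymmetrizer T * colAntisymmetrizer T)
  exact ⟨α, by rw [← hα]; simp only [youngSymmetrizer, mul_assoc]⟩

end Tableau

/-! ### The character of `ρ^λ` in terms of the Young symmetrizer -/

section Character

variable {n : ℕ} {lam : YoungDiagram} (T : Fin n ≃ lam.cells)

theorem coeff_youngSymmetrizer (u : Equiv.Perm (Fin n)) [DecidablePred (PreservesCols T)]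
    [DecidablePred (PreservesRows T)] :
    (youngSymmetrizer T).coeff u
      = ∑ τ with PreservesCols T τ, ∑ σ with PreservesRows T σ,
          if τ * σ = u then ((Equiv.Perm.sign τ : ℤ) : ℂ) else 0 := by
  classical
  rw [youngSymmetrizer, colAntisymmetrizer, rowSymmetrizer, Finset.sum_mul_sum]
  simp only [MonoidAlgebra.single_mul_single, mul_one, MonoidAlgebra.coeff_sum,
    Finsupp.coe_finsetSum, Finset.sum_apply, MonoidAlgebra.coeff_single, Finsupp.single_apply]
  refine Finset.sum_congr (by congr!) fun τ _ => Finset.sum_congr (by congr!) fun σ _ => ?_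
  congr!

/-- Only the trivial pair has product `1`, since a permutation preserving both rows and columns is
the identity. This normalizes `c` and later forces `α ≠ 0`. -/
theorem coeff_youngSymmetrizer_one : (youngSymmetrizer T).coeff 1 = 1 := by
  classical
  rw [coeff_youngSymmetrizer]
  have h1 : PreservesCols T 1 := fun _ => rfl
  have h2 : PreservesRows T 1 := fun _ => rfl
  rw [Finset.sum_eq_single_of_mem 1 (by simp [h1]), Finset.sum_eq_single_of_mem 1 (by simp [h2])]
  · simp
  · intro σ _ hσ
    rw [if_neg (by simpa using hσ)]
  · intro τ hτ hτ1
    refine Finset.sum_eq_zero fun σ hσ => if_neg fun h => hτ1 ?_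
    simp only [Finset.mem_filter, Finset.mem_univ, true_and] at hτ hσ
    ext1 x
    obtain ⟨y, rfl⟩ := σ.surjective x
    have hy : τ (σ y) = y := DFunLike.congr_fun h y
    refine tableau_ext T ?_ (hτ _)
    rw [hy, Equiv.Perm.one_apply, hσ]

/-- The diagonal entry at `h` is the coefficient of `h` in `g h c`. -/
theorem trace_mulLeft_mulRight {G : Type*} [Group G] [Fintype G] (g : G)
    (c : MonoidAlgebra ℂ G) :
    LinearMap.trace ℂ (MonoidAlgebra ℂ G)
        (LinearMap.mulLeft ℂ (MonoidAlgebra.single g 1) ∘ₗ LinearMap.mulRight ℂ c)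
      = ∑ h, c.coeff (h⁻¹ * g⁻¹ * h) := by
  classical
  rw [LinearMap.trace_eq_matrix_trace ℂ (MonoidAlgebra.basis G ℂ), Matrix.trace]
  refine Finset.sum_congr rfl fun h _ => ?_
  rw [Matrix.diag_apply, LinearMap.toMatrix_apply]
  change (MonoidAlgebra.single g 1 * (MonoidAlgebra.single h 1 * c)).coeff h = _
  simp [mul_assoc]

/-- The map `x ↦ g x c` factors through the Young module, and right multiplication by `c` acts on
that module as the scalar `α`. Cyclicity of the trace moves the computation to the module. -/
theorem exists_trace_youngRep :
    ∃ α : ℂ, ∀ g, α * LinearMap.trace ℂ _ (youngRep T g)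
      = ∑ h, (youngSymmetrizer T).coeff (h⁻¹ * g⁻¹ * h) := by
  obtain ⟨α, hα⟩ := youngSymmetrizer_mul_self T
  refine ⟨α, fun g => ?_⟩
  let R : MonoidAlgebra ℂ (Equiv.Perm (Fin n)) →ₗ[ℂ] youngModule T :=
    (LinearMap.mulRight ℂ (youngSymmetrizer T)).rangeRestrict
  have h1 : LinearMap.mulLeft ℂ (MonoidAlgebra.single g 1) ∘ₗ
      LinearMap.mulRight ℂ (youngSymmetrizer T)
      = (youngModule T).subtype ∘ₗ (youngRep T g ∘ₗ R) := by
    ext1 x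
    rfl
  have h2 : (youngRep T g ∘ₗ R) ∘ₗ (youngModule T).subtype = α • youngRep T g := by
    ext1 ⟨x, hx⟩
    obtain ⟨z, rfl⟩ := hx
    have : R ((youngModule T).subtype ⟨LinearMap.mulRight ℂ (youngSymmetrizer T) z, ⟨z, rfl⟩⟩)
        = α • ⟨LinearMap.mulRight ℂ (youngSymmetrizer T) z, ⟨z, rfl⟩⟩ := by
      apply Subtype.ext
      change z * youngSymmetrizer T * youngSymmetrizer T = α • (z * youngSymmetrizer T)
      rw [mul_assoc, hα, mul_smul_comm]
    rw [LinearMap.comp_apply, LinearMap.comp_apply, this, map_smul, LinearMap.smul_apply]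
  rw [← trace_mulLeft_mulRight, h1, LinearMap.trace_comp_comm', h2, map_smul, smul_eq_mul]

theorem trace_eq_of_isConj {G V : Type*} [Group G] [AddCommGroup V] [Module ℂ V]
    (ρ : Representation ℂ G V) {g h : G} (hgh : IsConj g h) :
    LinearMap.trace ℂ V (ρ g) = LinearMap.trace ℂ V (ρ h) := by
  obtain ⟨c, rfl⟩ := isConj_iff.1 hgh
  rw [map_mul, LinearMap.trace_mul_comm, ← map_mul]
  simp [← mul_assoc]

theorem isConj_inv_perm (g : Equiv.Perm (Fin n)) : IsConj g g⁻¹ :=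
  Equiv.Perm.isConj_iff_cycleType_eq.2 (Equiv.Perm.cycleType_inv g).symm

theorem trace_youngRep_one_ne_zero : LinearMap.trace ℂ _ (youngRep T 1) ≠ 0 := by
  obtain ⟨α, hα⟩ := exists_trace_youngRep T
  intro h
  have := hα 1
  rw [h] at this
  simp [coeff_youngSymmetrizer_one, Fintype.card_perm, eq_comm, Nat.factorial_ne_zero] at this

theorem normalizedCharacter_youngRep (g : Equiv.Perm (Fin n)) :
    normalizedCharacter (youngRep T) g
      = (n.factorial : ℂ)⁻¹ * ∑ h, (youngSymmetrizer T).coeff (h⁻¹ * g * h) := by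
  obtain ⟨α, hα⟩ := exists_trace_youngRep T
  have h1 : α * LinearMap.trace ℂ _ (youngRep T 1) = n.factorial := by
    rw [hα 1]
    simp [coeff_youngSymmetrizer_one, Fintype.card_perm]
  have h0 : (n.factorial : ℂ) ≠ 0 := by exact_mod_cast n.factorial_ne_zero
  have hg := hα g⁻¹
  -- A permutation is conjugate to its inverse, which removes the inverse from the trace formula.
  rw [inv_inv, ← trace_eq_of_isConj _ (isConj_inv_perm g)] at hg
  rw [← hg, ← h1, normalizedCharacter]
  have hα0 : α ≠ 0 := fun h => h0 (by rw [← h1, h, zero_mul])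
  have := trace_youngRep_one_ne_zero T
  field_simp

end Character

/-! ### Normalized conjugacy classes over arbitrary finite types and their expectation -/

section ViaEmbedding

variable {X α : Type*} [Fintype X] [DecidableEq α]

theorem Equiv.Perm.viaFintypeEmbedding_injective (f : X ↪ α) :
    Function.Injective fun σ : Equiv.Perm X => σ.viaFintypeEmbedding f := by
  intro σ τ h
  ext1 x
  have := DFunLike.congr_fun h (f x)
  simpa [Equiv.Perm.viaFintypeEmbedding_apply_image] using this

theorem Equiv.Perm.viaFintypeEmbedding_mul (σ τ : Equiv.Perm X) (f : X ↪ α) :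
    (σ * τ).viaFintypeEmbedding f = σ.viaFintypeEmbedding f * τ.viaFintypeEmbedding f := by
  ext1 a
  by_cases ha : a ∈ Set.range f
  · obtain ⟨x, rfl⟩ := ha
    simp [Equiv.Perm.viaFintypeEmbedding_apply_image]
  · simp [Equiv.Perm.viaFintypeEmbedding_apply_notMem_range _ _ ha]

theorem Equiv.Perm.exists_viaFintypeEmbedding_eq (f : X ↪ α) (σ : Equiv.Perm α)
    (h : ∀ a ∉ Set.range f, σ a = a) : ∃ σ' : Equiv.Perm X, σ'.viaFintypeEmbedding f = σ := by
  have hiff : ∀ a, σ a ∈ Set.range f ↔ a ∈ Set.range f := by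
    intro a
    constructor
    · intro ha
      by_contra hn
      exact hn (h a hn ▸ ha)
    · intro ha
      by_contra hn
      have := σ.injective (h _ hn)
      exact hn (by rwa [this])
  let e : X ≃ Set.range f := f.toEquivRange
  refine ⟨e.symm.permCongr (σ.subtypePerm hiff), ?_⟩
  ext1 a
  by_cases ha : a ∈ Set.range f
  · obtain ⟨x, rfl⟩ := ha
    rw [Equiv.Perm.viaFintypeEmbedding_apply_image, Equiv.permCongr_apply]
    have h1 : ∀ y : Set.range f, f (e.symm y) = y := fun y => by
      obtain ⟨z, rfl⟩ := e.surjective y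
      rw [Equiv.symm_apply_apply]
      rfl
    rw [h1]
    rfl
  · rw [Equiv.Perm.viaFintypeEmbedding_apply_notMem_range _ _ ha, h a ha]

theorem Equiv.Perm.viaFintypeEmbedding_trans_perm (σ : Equiv.Perm X) (f : X ↪ α)
    (g : Equiv.Perm α) :
    σ.viaFintypeEmbedding (f.trans g.toEmbedding) = g * σ.viaFintypeEmbedding f * g⁻¹ := by
  ext1 a
  obtain ⟨a, rfl⟩ := g.surjective a
  by_cases ha : a ∈ Set.range f
  · obtain ⟨x, rfl⟩ := ha
    have := Equiv.Perm.viaFintypeEmbedding_apply_image σ (f.trans g.toEmbedding) x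
    simp only [Function.Embedding.trans_apply, Equiv.coe_toEmbedding] at this
    simp [this, Equiv.Perm.viaFintypeEmbedding_apply_image]
  · rw [Equiv.Perm.viaFintypeEmbedding_apply_notMem_range]
    · simp [Equiv.Perm.viaFintypeEmbedding_apply_notMem_range _ _ ha]
    · rintro ⟨x, hx⟩
      exact ha ⟨x, g.injective hx⟩

end ViaEmbedding

/-- The partial permutation obtained by placing a permutation of a finite type `X` on the image of
an embedding. -/
def PartialPermutation.placeFintype {X α : Type*} [Fintype X] [DecidableEq α] (π : Equiv.Perm X)
    (f : X ↪ α) : PartialPermutation α where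
  supp := Finset.univ.map f
  perm := π.viaFintypeEmbedding f
  fix x hx := Equiv.Perm.viaFintypeEmbedding_apply_notMem_range π f (by simpa using hx)

/-- The normalized conjugacy class of a permutation of a finite type. -/
noncomputable def classSum {X : Type*} [Fintype X] [DecidableEq X] (n : ℕ) (π : Equiv.Perm X) :
    DisjointAlgebra (Fin n) :=
  ∑ f : X ↪ Fin n, DisjointAlgebra.of (PartialPermutation.placeFintype π f)

/-- A function from `X` to the boxes of a diagram is adapted to a pair `(σ₁, σ₂)` of permutations
of `X` if its column is constant on the cycles of `σ₁` and its row on the cycles of `σ₂`. -/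
def Adapted {X : Type*} (σ : Equiv.Perm X × Equiv.Perm X) (f : X → ℕ × ℕ) : Prop :=
  (∀ x, (f (σ.1 x)).2 = (f x).2) ∧ ∀ x, (f (σ.2 x)).1 = (f x).1

section Expectation

variable {n : ℕ} {lam : YoungDiagram} (T : Fin n ≃ lam.cells)
  {X : Type*} [Fintype X] [DecidableEq X]

open Classical in
-- Conjugating a placement of `π` by `h` is placing `π` along another embedding, so every `h`
-- contributes the same sum and the average is trivial.
theorem charExpectation_classSum_eq_sum_coeff (π : Equiv.Perm X) :
    charExpectation (youngRep T) (classSum n π)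
      = ∑ f : X ↪ Fin n, (youngSymmetrizer T).coeff (π.viaFintypeEmbedding f) := by
  have h1 : ∀ h : Equiv.Perm (Fin n),
      ∑ f : X ↪ Fin n, (youngSymmetrizer T).coeff (h⁻¹ * π.viaFintypeEmbedding f * h)
        = ∑ f : X ↪ Fin n, (youngSymmetrizer T).coeff (π.viaFintypeEmbedding f) := by
    intro h
    refine Fintype.sum_equiv (Equiv.embeddingCongr (Equiv.refl X) h⁻¹) _ _ fun f => ?_
    have : Equiv.embeddingCongr (Equiv.refl X) h⁻¹ f = f.trans (h⁻¹).toEmbedding := by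
      ext x
      rfl
    rw [this, Equiv.Perm.viaFintypeEmbedding_trans_perm, inv_inv]
  have h0 : (n.factorial : ℂ) ≠ 0 := by exact_mod_cast n.factorial_ne_zero
  rw [classSum, map_sum]
  simp only [charExpectation, DisjointAlgebra.lift_of, normalizedCharacter_youngRep]
  rw [← Finset.mul_sum, Finset.sum_comm]
  simp only [PartialPermutation.placeFintype]
  rw [Finset.sum_congr rfl fun h _ => h1 h]
  simp [Fintype.card_perm, h0]

/-- The entry `σ x` shares its row with `x` and its column with `τ (σ x) = x`. Thus factorizations
of a placed permutation never leave the image of the embedding. -/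
theorem fixed_of_mul_fixed {τ σ : Equiv.Perm (Fin n)} (hτ : PreservesCols T τ)
    (hσ : PreservesRows T σ) {x : Fin n} (h : τ (σ x) = x) : σ x = x ∧ τ x = x := by
  have h1 : σ x = x := by
    refine tableau_ext T (hσ x) ?_
    rw [← hτ (σ x), h]
  exact ⟨h1, by rwa [h1] at h⟩

open Classical in
theorem coeff_youngSymmetrizer_viaFintypeEmbedding (π : Equiv.Perm X) (f : X ↪ Fin n) :
    (youngSymmetrizer T).coeff (π.viaFintypeEmbedding f)
      = ∑ σ : Equiv.Perm X × Equiv.Perm X with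
          σ.1 * σ.2 = π ∧ Adapted σ (fun x => (T (f x)).1),
          ((Equiv.Perm.sign σ.1 : ℤ) : ℂ) := by
  rw [coeff_youngSymmetrizer, ← Finset.sum_product', ← Finset.sum_filter]
  symm
  -- Here `k` is a coordinate of the box. Off the image of `f` nothing moves, so preserving rows or
  -- columns is a condition on `X` only.
  have key : ∀ (σ : Equiv.Perm X) (k : ℕ × ℕ → ℕ),
      (∀ x, k (T (σ.viaFintypeEmbedding f x)).1 = k (T x).1) ↔
        ∀ x, k (T (f (σ x))).1 = k (T (f x)).1 := by
    intro σ k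
    constructor
    · intro h x
      rw [← h (f x), Equiv.Perm.viaFintypeEmbedding_apply_image]
    · intro h a
      by_cases ha : a ∈ Set.range f
      · obtain ⟨x, rfl⟩ := ha
        rw [Equiv.Perm.viaFintypeEmbedding_apply_image, h]
      · rw [Equiv.Perm.viaFintypeEmbedding_apply_notMem_range _ _ ha]
  refine Finset.sum_bij
    (fun σ _ => (σ.1.viaFintypeEmbedding f, σ.2.viaFintypeEmbedding f)) ?_ ?_ ?_ ?_
  · rintro ⟨σ₁, σ₂⟩ h
    simp only [Finset.mem_filter, Finset.mem_univ, true_and, Finset.mem_product] at h ⊢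
    exact ⟨⟨(key σ₁ Prod.snd).2 h.2.1, (key σ₂ Prod.fst).2 h.2.2⟩, by
      rw [← h.1, Equiv.Perm.viaFintypeEmbedding_mul]⟩
  · rintro ⟨σ₁, σ₂⟩ _ ⟨τ₁, τ₂⟩ _ h
    rw [Prod.mk.injEq] at h
    exact Prod.ext (Equiv.Perm.viaFintypeEmbedding_injective f h.1)
      (Equiv.Perm.viaFintypeEmbedding_injective f h.2)
  · rintro ⟨τ, σ⟩ h
    simp only [Finset.mem_filter, Finset.mem_univ, true_and, Finset.mem_product] at h
    obtain ⟨⟨hτ, hσ⟩, hmul⟩ := h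
    have hfix : ∀ a ∉ Set.range f, σ a = a ∧ τ a = a := fun a ha => by
      refine fixed_of_mul_fixed T hτ hσ ?_
      rw [← Equiv.Perm.mul_apply, hmul, Equiv.Perm.viaFintypeEmbedding_apply_notMem_range _ _ ha]
    obtain ⟨σ', rfl⟩ := Equiv.Perm.exists_viaFintypeEmbedding_eq f σ fun a ha => (hfix a ha).1
    obtain ⟨τ', rfl⟩ := Equiv.Perm.exists_viaFintypeEmbedding_eq f τ fun a ha => (hfix a ha).2
    refine ⟨(τ', σ'), ?_, rfl⟩
    rw [← Equiv.Perm.viaFintypeEmbedding_mul] at hmul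
    simp only [Finset.mem_filter, Finset.mem_univ, true_and]
    exact ⟨Equiv.Perm.viaFintypeEmbedding_injective f hmul,
      (key τ' Prod.snd).1 hτ, (key σ' Prod.fst).1 hσ⟩
  · rintro ⟨σ₁, σ₂⟩ _
    simp

open Classical in
-- If `f x = f y`, inserting the transposition of `x` and `y` twice between `σ₁` and `σ₂` keeps the
-- product and adaptedness and flips the sign: a sign-reversing involution without fixed points.
theorem sum_sign_adapted_eq_zero (π : Equiv.Perm X) (f : X → ℕ × ℕ)
    (hf : ¬ Function.Injective f) :
    ∑ σ : Equiv.Perm X × Equiv.Perm X with σ.1 * σ.2 = π ∧ Adapted σ f,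
      ((Equiv.Perm.sign σ.1 : ℤ) : ℂ) = 0 := by
  simp only [Function.Injective, not_forall] at hf
  obtain ⟨x, y, hxy, hne⟩ := hf
  have hs : ∀ z, f (Equiv.swap x y z) = f z := fun z => by
    by_cases hzx : z = x
    · simp [hzx, hxy]
    by_cases hzy : z = y
    · simp [hzy, hxy]
    rw [Equiv.swap_apply_of_ne_of_ne hzx hzy]
  refine Finset.sum_involution
    (fun σ _ => (σ.1 * Equiv.swap x y, Equiv.swap x y * σ.2)) ?_ ?_ ?_ ?_
  · rintro ⟨σ₁, σ₂⟩ _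
    simp [Equiv.Perm.sign_swap hne]
  · rintro ⟨σ₁, σ₂⟩ _ _ h
    rw [Prod.mk.injEq, mul_eq_left] at h
    exact hne (Equiv.swap_eq_one_iff.1 h.1)
  · rintro ⟨σ₁, σ₂⟩ h
    simp only [Finset.mem_filter, Finset.mem_univ, true_and] at h ⊢
    refine ⟨?_, fun z => ?_, fun z => ?_⟩
    · rw [mul_assoc, ← mul_assoc (Equiv.swap x y), Equiv.swap_mul_self, one_mul, h.1]
    · rw [Equiv.Perm.mul_apply, h.2.1, hs]
    · rw [Equiv.Perm.mul_apply, hs, h.2.2]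
  · rintro ⟨σ₁, σ₂⟩ _
    simp [mul_assoc, ← mul_assoc (Equiv.swap x y)]

open Classical in
theorem charExpectation_classSum (π : Equiv.Perm X) :
    charExpectation (youngRep T) (classSum n π)
      = ∑ f ∈ Fintype.piFinset fun _ : X => lam.cells,
          ∑ σ : Equiv.Perm X × Equiv.Perm X with σ.1 * σ.2 = π ∧ Adapted σ f,
            ((Equiv.Perm.sign σ.1 : ℤ) : ℂ) := by
  rw [charExpectation_classSum_eq_sum_coeff]
  refine Finset.sum_of_injOn (fun f x => (T (f x)).1) ?_ ?_ ?_ ?_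
  · intro f _ g _ h
    ext1 x
    exact T.injective (Subtype.ext (congr_fun h x))
  · intro f _
    simp
  · intro F hF hn
    refine sum_sign_adapted_eq_zero π F fun hinj => hn ?_
    rw [Fintype.mem_piFinset] at hF
    refine ⟨⟨fun x => T.symm ⟨F x, hF x⟩, fun x y h => hinj ?_⟩, by simp, ?_⟩
    · simpa using h
    · ext1 x
      exact congrArg Subtype.val (T.apply_symm_apply ⟨F x, hF x⟩)
  · intro f _
    exact coeff_youngSymmetrizer_viaFintypeEmbedding T π f

end Expectation

/-! ### Disjoint products of normalized conjugacy classes -/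

theorem comp_placeFintype {X Y α : Type*} [Fintype X] [Fintype Y] [DecidableEq α] (π : Equiv.Perm X) (π' : Equiv.Perm Y)
    (F : X ⊕ Y ↪ α) :
    (PartialPermutation.placeFintype π (Function.Embedding.inl.trans F)).comp
        (PartialPermutation.placeFintype π' (Function.Embedding.inr.trans F))
      = PartialPermutation.placeFintype (Equiv.Perm.sumCongr π π') F := by
  ext1
  · ext a
    simp [PartialPermutation.comp, PartialPermutation.placeFintype]
  · ext1 a
    simp only [PartialPermutation.comp, PartialPermutation.placeFintype, Equiv.Perm.mul_apply]
    by_cases ha : a ∈ Set.range F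
    · obtain ⟨x | y, rfl⟩ := ha
      · have hx : F (Sum.inl x) ∉ Set.range (Function.Embedding.inr.trans F : Y ↪ α) := by
          rintro ⟨y, hy⟩
          exact Sum.inr_ne_inl (F.injective hy)
        rw [Equiv.Perm.viaFintypeEmbedding_apply_notMem_range _ _ hx,
          Equiv.Perm.viaFintypeEmbedding_apply_image]
        exact Equiv.Perm.viaFintypeEmbedding_apply_image π (Function.Embedding.inl.trans F) x
      · have hy : F (Sum.inr (π' y)) ∉ Set.range (Function.Embedding.inl.trans F : X ↪ α) := by
          rintro ⟨x, hx⟩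
          exact Sum.inl_ne_inr (F.injective hx)
        have := Equiv.Perm.viaFintypeEmbedding_apply_image π' (Function.Embedding.inr.trans F) y
        simp only [Function.Embedding.trans_apply, Function.Embedding.inr_apply] at this
        rw [this, Equiv.Perm.viaFintypeEmbedding_apply_notMem_range _ _ hy,
          Equiv.Perm.viaFintypeEmbedding_apply_image]
        rfl
    · rw [Equiv.Perm.viaFintypeEmbedding_apply_notMem_range _ F ha,
        Equiv.Perm.viaFintypeEmbedding_apply_notMem_range _ (Function.Embedding.inr.trans F),
        Equiv.Perm.viaFintypeEmbedding_apply_notMem_range _ (Function.Embedding.inl.trans F)]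
      · rintro ⟨x, rfl⟩
        exact ha ⟨_, rfl⟩
      · rintro ⟨x, rfl⟩
        exact ha ⟨_, rfl⟩

section Product

variable {X Y : Type*} [Fintype X] [DecidableEq X] [Fintype Y] [DecidableEq Y]

theorem classSum_congr (n : ℕ) (e : X ≃ Y) {π : Equiv.Perm X} {π' : Equiv.Perm Y}
    (h : ∀ x, e (π x) = π' (e x)) : classSum n π = classSum n π' := by
  refine Fintype.sum_equiv (Equiv.embeddingCongr e (Equiv.refl _)) _ _ fun f => ?_
  congr 1
  have hf : ∀ x, Equiv.embeddingCongr e (Equiv.refl (Fin n)) f (e x) = f x := fun x => by simp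
  ext1
  · ext a
    simp only [PartialPermutation.placeFintype, Finset.mem_map, Finset.mem_univ, true_and]
    constructor
    · rintro ⟨x, rfl⟩
      exact ⟨e x, hf x⟩
    · rintro ⟨y, rfl⟩
      obtain ⟨x, rfl⟩ := e.surjective y
      exact ⟨x, (hf x).symm⟩
  · ext1 a
    simp only [PartialPermutation.placeFintype]
    by_cases ha : a ∈ Set.range f
    · obtain ⟨x, rfl⟩ := ha
      rw [Equiv.Perm.viaFintypeEmbedding_apply_image, ← hf x,
        Equiv.Perm.viaFintypeEmbedding_apply_image, ← h, hf]
    · rw [Equiv.Perm.viaFintypeEmbedding_apply_notMem_range _ _ ha,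
        Equiv.Perm.viaFintypeEmbedding_apply_notMem_range]
      rintro ⟨y, rfl⟩
      obtain ⟨x, rfl⟩ := e.surjective y
      exact ha ⟨x, (hf x).symm⟩

/-- Pairs of embeddings with disjoint images are the embeddings of `X ⊕ Y`; the disjoint product
kills all other pairs. -/
theorem classSum_mul_classSum (n : ℕ) (π : Equiv.Perm X) (π' : Equiv.Perm Y) :
    classSum n π * classSum n π' = classSum n (Equiv.Perm.sumCongr π π') := by
  classical
  rw [classSum, classSum, classSum, Finset.sum_mul_sum, ← Finset.sum_product']
  symm
  refine Finset.sum_of_injOn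
    (fun F => (Function.Embedding.inl.trans F, Function.Embedding.inr.trans F)) ?_ ?_ ?_ ?_
  · intro F _ G _ h
    rw [Prod.mk.injEq] at h
    ext1 (x | y)
    · exact DFunLike.congr_fun h.1 x
    · exact DFunLike.congr_fun h.2 y
  · intro F _
    simp
  · rintro ⟨f, g⟩ _ hn
    rw [DisjointAlgebra.of_mul_of, if_neg]
    intro hd
    refine hn ⟨Equiv.sumEmbeddingEquivProdEmbeddingDisjoint.symm ⟨(f, g), ?_⟩, by simp, ?_⟩
    · rw [Set.disjoint_left]
      rintro _ ⟨x, rfl⟩ ⟨y, hy⟩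
      rw [Finset.disjoint_left] at hd
      refine hd (a := f x) ?_ ?_
      · simp [PartialPermutation.placeFintype]
      · simp [PartialPermutation.placeFintype, ← hy]
    · rfl
  · intro F _
    rw [DisjointAlgebra.of_mul_of, if_pos, comp_placeFintype]
    rw [Finset.disjoint_left]
    simp only [PartialPermutation.placeFintype, Finset.mem_map, Finset.mem_univ, true_and]
    rintro _ ⟨x, rfl⟩ ⟨y, hy⟩
    exact Sum.inr_ne_inl (F.injective hy)

theorem classSum_of_isEmpty [IsEmpty X] (n : ℕ) (π : Equiv.Perm X) : classSum n π = 1 := by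
  rw [classSum, Fintype.sum_unique]
  refine congrArg DisjointAlgebra.of (PartialPermutation.ext ?_ ?_)
  · simp [PartialPermutation.placeFintype, PartialPermutation.empty]
  · ext1 a
    exact Equiv.Perm.viaFintypeEmbedding_apply_notMem_range _ _ (by rintro ⟨x, _⟩; exact isEmptyElim x)

end Product

/-! ### Products of classes over a set of blocks -/

section Blocks

variable {ι : Type*} [DecidableEq ι] {l : ι → ℕ}

/-- The product of the permutations `π i`, `i ∈ s`, on the blocks indexed by `s`. -/
def blockPerm (π : (i : ι) → Equiv.Perm (Fin (l i))) (s : Finset ι) :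
    Equiv.Perm {x : Σ i, Fin (l i) // x.1 ∈ s} :=
  (Equiv.Perm.sigmaCongrRight π).subtypePerm fun _ => Iff.rfl

instance (s : Finset ι) : Fintype {x : Σ i, Fin (l i) // x.1 ∈ s} :=
  Fintype.ofEquiv (Σ i : s, Fin (l i))
    { toFun := fun x => ⟨⟨x.1, x.2⟩, x.1.2⟩
      invFun := fun x => ⟨⟨x.1.1, x.2⟩, x.1.2⟩
      left_inv := fun _ => rfl
      right_inv := fun _ => rfl }

theorem prod_conjClassSum (n : ℕ) (π : (i : ι) → Equiv.Perm (Fin (l i))) (s : Finset ι) :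
    ∏ i ∈ s, conjClassSum n (π i) = classSum n (blockPerm π s) := by
  induction s using Finset.induction_on with
  | empty =>
    have : IsEmpty {x : Σ i, Fin (l i) // x.1 ∈ (∅ : Finset ι)} := ⟨fun x => by simpa using x.2⟩
    rw [Finset.prod_empty, classSum_of_isEmpty]
  | insert a s ha ih =>
    have h : conjClassSum n (π a) = classSum n (π a) := rfl
    rw [Finset.prod_insert ha, ih, h, classSum_mul_classSum]
    let e : Fin (l a) ⊕ {x : Σ i, Fin (l i) // x.1 ∈ s} →
        {x : Σ i, Fin (l i) // x.1 ∈ insert a s} :=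
      Sum.elim (fun k => ⟨⟨a, k⟩, Finset.mem_insert_self a s⟩)
        (fun x => ⟨x.1, Finset.mem_insert_of_mem x.2⟩)
    have he : Function.Bijective e := by
      constructor
      · rintro (k | ⟨x, hx⟩) (k' | ⟨x', hx'⟩) h
        · simpa [e] using h
        · have := congrArg Subtype.val h
          simp only [e, Sum.elim_inl, Sum.elim_inr] at this
          exact (ha (by rw [← this] at hx'; exact hx')).elim
        · have := congrArg Subtype.val h
          simp only [e, Sum.elim_inl, Sum.elim_inr] at this
          exact (ha (by rw [this] at hx; exact hx)).elim
        · simpa [e] using h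
      · rintro ⟨⟨i, k⟩, hi⟩
        rcases Finset.mem_insert.1 hi with h | h
        · subst h
          exact ⟨Sum.inl k, rfl⟩
        · exact ⟨Sum.inr ⟨⟨i, k⟩, h⟩, rfl⟩
    refine classSum_congr n (Equiv.ofBijective e he) ?_
    rintro (k | ⟨⟨i, k⟩, hi⟩) <;> rfl

end Blocks

/-! ### Cumulants by splitting off the block of a marked element -/

section Cumulant

variable {ι : Type*} [DecidableEq ι]

/-- A partition of `s` is the block `B` containing `a` together with a partition of the rest. -/
theorem Finpartition.sum_prod_parts_eq (k : Finset ι → ℂ) {s : Finset ι} {a : ι} (ha : a ∈ s) :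
    ∑ P : Finpartition s, ∏ B ∈ P.parts, k B
      = ∑ B ∈ s.powerset with a ∈ B, k B * ∑ P : Finpartition (s \ B), ∏ C ∈ P.parts, k C := by
  simp only [Finset.mul_sum]
  rw [Finset.sum_sigma']
  symm
  have hB : ∀ p : (Σ B : Finset ι, Finpartition (s \ B)),
      p ∈ ({B ∈ s.powerset | a ∈ B}).sigma (fun B => (Finset.univ : Finset (Finpartition (s \ B))))
        → p.1 ⊆ s ∧ a ∈ p.1 := by
    rintro ⟨B, P⟩ hp
    simpa using hp
  have hnot : ∀ p : (Σ B : Finset ι, Finpartition (s \ B)), a ∈ p.1 → ∀ C ∈ p.2.parts, a ∉ C :=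
    fun p hp C hC haC => (Finset.mem_sdiff.1 (p.2.le hC haC)).2 hp
  refine Finset.sum_bij (fun p hp => p.2.extend (b := p.1) (c := s)
    (Finset.ne_empty_of_mem (hB p hp).2) Finset.sdiff_disjoint
    (Finset.sdiff_union_of_subset (hB p hp).1)) ?_ ?_ ?_ ?_
  · intro p hp
    exact Finset.mem_univ _
  · rintro ⟨B, P⟩ hp ⟨B', P'⟩ hp' h
    have h1 : insert B P.parts = insert B' P'.parts := congrArg Finpartition.parts h
    have hn := hnot ⟨B, P⟩ (hB _ hp).2
    have hn' := hnot ⟨B', P'⟩ (hB _ hp').2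
    have haB := (hB _ hp).2
    have haB' := (hB _ hp').2
    simp only at hn hn' haB haB'
    have h2 : B = B' := by
      have : B ∈ insert B' P'.parts := h1 ▸ Finset.mem_insert_self _ _
      rcases Finset.mem_insert.1 this with h | h
      · exact h
      · exact (hn' B h haB).elim
    subst h2
    have h3 : P.parts = P'.parts := by
      rw [← Finset.erase_insert (fun h => hn B h haB), h1,
        Finset.erase_insert (fun h => hn' B h haB)]
    rw [Finpartition.ext h3]
  · intro P _
    have hmem : P.part a ∈ P.parts := P.part_mem.2 ha
    have haP : a ∈ P.part a := P.mem_part_self.2 ha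
    refine ⟨⟨P.part a, P.avoid (P.part a)⟩, ?_, ?_⟩
    · simp [P.part_subset a, haP]
    · apply Finpartition.ext
      change insert (P.part a) (P.avoid (P.part a)).parts = P.parts
      have hdisj : ∀ D ∈ P.parts, D ≠ P.part a → D \ P.part a = D := fun D hD hne =>
        Finset.sdiff_eq_self_of_disjoint (P.disjoint hD hmem hne)
      ext C
      simp only [Finset.mem_insert, Finpartition.mem_avoid]
      constructor
      · rintro (rfl | ⟨D, hD, hnle, rfl⟩)
        · exact hmem
        · rw [hdisj D hD (fun h => hnle h.le)]
          exact hD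
      · intro hC
        by_cases h : C = P.part a
        · exact Or.inl h
        · refine Or.inr ⟨C, hC, fun hle => ?_, hdisj C hC h⟩
          obtain ⟨x, hx⟩ := P.nonempty_of_mem_parts hC
          exact h (P.eq_of_mem_parts hC hmem hx (hle hx))
  · rintro p hp
    change _ = ∏ C ∈ insert p.1 p.2.parts, k C
    rw [Finset.prod_insert fun h => hnot p (hB p hp).2 _ h (hB p hp).2]

/-- The cumulants satisfy the same recursion. By induction the terms with `B ≠ s` agree and cancel,
and the term `B = s` has the factor `E 1 = 1`. -/
theorem jointCumulant_eq_of_recursion {A : Type*} [CommRing A] [Module ℂ A] (E : A →ₗ[ℂ] ℂ)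
    (X : ι → A) (h1 : E 1 = 1) (K : Finset ι → ℂ)
    (hK : ∀ (s : Finset ι) (a : ι), a ∈ s →
      E (∏ i ∈ s, X i) = ∑ B ∈ s.powerset with a ∈ B, K B * E (∏ i ∈ s \ B, X i))
    (s : Finset ι) (hs : s.Nonempty) : jointCumulant E X s = K s := by
  induction s using Finset.strongInduction with
  | H s ih =>
    obtain ⟨a, ha⟩ := hs
    have hpart : ∀ t : Finset ι,
        ∑ P : Finpartition t, ∏ C ∈ P.parts, jointCumulant E X C = E (∏ i ∈ t, X i) := by
      intro t
      -- The remainder `s \ B` may be empty; its only partition has no blocks, so the sum is the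
      -- empty product `1 = E 1`.
      rcases t.eq_empty_or_nonempty with rfl | ht
      · have : Unique (Finpartition (∅ : Finset ι)) :=
          inferInstanceAs (Unique (Finpartition (⊥ : Finset ι)))
        rw [Fintype.sum_unique, Finpartition.parts_eq_empty_iff.2 rfl]
        simp [h1]
      · exact (moment_eq_sum_jointCumulant E X t ht).symm
    have h2 := hpart s
    rw [Finpartition.sum_prod_parts_eq _ ha, hK s a ha] at h2
    simp only [hpart] at h2
    have hmem : s ∈ s.powerset.filter (a ∈ ·) := by simp [ha]
    rw [← Finset.add_sum_erase _ _ hmem, ← Finset.add_sum_erase _ _ hmem,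
      Finset.sum_congr rfl fun B hB => ?_] at h2
    · have := add_right_cancel h2
      simpa [h1] using this
    · simp only [Finset.mem_erase, Finset.mem_filter, Finset.mem_powerset] at hB
      rw [ih B (Finset.ssubset_iff_subset_ne.2 ⟨hB.2.1, hB.1⟩) ⟨a, hB.2.2⟩]

end Cumulant

/-! ### Splitting a factorization into its connected components -/

section Splitting

variable {X ι : Type*}

theorem Equiv.Perm.mem_iff_of_fixed {p : X → Prop} (σ : Equiv.Perm X)
    (h : ∀ x, ¬ p x → σ x = x) (x : X) : p (σ x) ↔ p x := by
  constructor
  · intro hx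
    by_contra hn
    exact hn (by rwa [h x hn] at hx)
  · intro hx
    by_contra hn
    have := σ.injective (h _ hn)
    exact hn (by rwa [this])

theorem Equiv.Perm.exists_restrict {p : X → Prop} (σ : Equiv.Perm X)
    (h : ∀ x, p (σ x) ↔ p x) :
    ∃ τ : Equiv.Perm X, (∀ x, p x → τ x = σ x) ∧ ∀ x, ¬ p x → τ x = x := by
  classical
  refine ⟨Equiv.Perm.ofSubtype (σ.subtypePerm h), fun x hx => ?_, fun x hx => ?_⟩
  · rw [Equiv.Perm.ofSubtype_apply_of_mem _ hx]
    rfl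
  · exact Equiv.Perm.ofSubtype_apply_of_not_mem _ hx

/-- A pair of permutations of `X` and a function from `X` to boxes. -/
abbrev Triple (X : Type*) : Type _ := Equiv.Perm X × Equiv.Perm X × (X → ℕ × ℕ)

variable (c : X → ι) (π : Equiv.Perm X) (S : Finset (ℕ × ℕ))

/-- The triple lives on the points with label in `s`, where it is a factorization of `π` with an
adapted function to `S`. -/
structure IsColored (s : Finset ι) (t : Triple X) : Prop where
  fix₁ : ∀ x, c x ∉ s → t.1 x = x
  fix₂ : ∀ x, c x ∉ s → t.2.1 x = x
  mul : ∀ x, c x ∈ s → t.1 (t.2.1 x) = π x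
  mem : ∀ x, c x ∈ s → t.2.2 x ∈ S
  zero : ∀ x, c x ∉ s → t.2.2 x = 0
  col : ∀ x, (t.2.2 (t.1 x)).2 = (t.2.2 x).2
  row : ∀ x, (t.2.2 (t.2.1 x)).1 = (t.2.2 x).1

/-- The set of points with label in `B` is invariant under both permutations. -/
def IsStableOn (B : Finset ι) (t : Triple X) : Prop :=
  ∀ x, (c (t.1 x) ∈ B ↔ c x ∈ B) ∧ (c (t.2.1 x) ∈ B ↔ c x ∈ B)

/-- No proper nonempty part of `B` is invariant. -/
def IsConnectedOn (B : Finset ι) (t : Triple X) : Prop :=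
  ∀ C ⊆ B, C.Nonempty → IsStableOn c C t → C = B

variable {c π S}

theorem IsColored.isStableOn {s : Finset ι} {t : Triple X} (h : IsColored c π S s t) :
    IsStableOn c s t := fun x =>
  ⟨Equiv.Perm.mem_iff_of_fixed t.1 h.fix₁ x, Equiv.Perm.mem_iff_of_fixed t.2.1 h.fix₂ x⟩

/-- The product of two triples, of interest when they live on disjoint sets. -/
def Triple.merge (t u : Triple X) : Triple X := (t.1 * u.1, t.2.1 * u.2.1, t.2.2 + u.2.2)

theorem Equiv.Perm.mul_apply_of_fixed {p q : X → Prop} (hpq : ∀ x, p x → ¬ q x)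
    {σ τ : Equiv.Perm X} (hσ : ∀ x, ¬ p x → σ x = x) (hτ : ∀ x, ¬ q x → τ x = x) (x : X) :
    (p x → (σ * τ) x = σ x) ∧ (¬ p x → (σ * τ) x = τ x) := by
  refine ⟨fun hx => by rw [Equiv.Perm.mul_apply, hτ x (hpq x hx)], fun hx => ?_⟩
  rw [Equiv.Perm.mul_apply]
  refine hσ _ fun h => ?_
  by_cases hq : q x
  · exact hpq _ h ((Equiv.Perm.mem_iff_of_fixed τ hτ x).2 hq)
  · rw [hτ x hq] at h
    exact hx h

variable [DecidableEq ι] {s B : Finset ι} {t u : Triple X}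

/-- The component is the intersection of all stable subsets of `s` containing `a`. A nonempty stable
part of it that misses `a` would have a smaller stable complement containing `a`. Any other
candidate contains this intersection, hence equals it by its own connectedness. -/
theorem existsUnique_component (hs : IsStableOn c s t) {a : ι} (ha : a ∈ s) :
    ∃! B, B ∈ s.powerset.filter (a ∈ ·) ∧ IsStableOn c B t ∧ IsConnectedOn c B t := by
  classical
  let B : Finset ι := s.filter fun j => ∀ C ⊆ s, a ∈ C → IsStableOn c C t → j ∈ C
  have hBs : B ⊆ s := Finset.filter_subset _ _
  have haB : a ∈ B := Finset.mem_filter.2 ⟨ha, fun C _ haC _ => haC⟩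
  have hmin : ∀ C ⊆ s, a ∈ C → IsStableOn c C t → B ⊆ C := fun C hC haC hCi j hj =>
    (Finset.mem_filter.1 hj).2 C hC haC hCi
  have hBi : IsStableOn c B t := by
    intro x
    simp only [B, Finset.mem_filter, (hs x).1, (hs x).2]
    constructor <;> refine and_congr_right fun _ => forall_congr' fun C => forall_congr' fun _ =>
      forall_congr' fun _ => forall_congr' fun hC => ?_
    · exact (hC x).1
    · exact (hC x).2
  have hBc : IsConnectedOn c B t := by
    intro C hC ⟨j, hj⟩ hCi
    by_cases haC : a ∈ C
    · exact Finset.Subset.antisymm hC (hmin C (hC.trans hBs) haC hCi)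
    · have hd : IsStableOn c (B \ C) t := fun x => by
        simp [(hBi x).1, (hBi x).2, (hCi x).1, (hCi x).2]
      have := hmin (B \ C) (Finset.sdiff_subset.trans hBs) (Finset.mem_sdiff.2 ⟨haB, haC⟩) hd
        (hC hj)
      exact ((Finset.mem_sdiff.1 this).2 hj).elim
  refine ⟨B, ⟨by simp [hBs, haB], hBi, hBc⟩, ?_⟩
  rintro B' ⟨h1, h2, h3⟩
  simp only [Finset.mem_filter, Finset.mem_powerset] at h1
  exact (h3 B (hmin B' h1.1 h1.2 h2) ⟨a, haB⟩ hBi).symm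

/-! ### Gluing and cutting triples along a stable set of labels -/

section Merge

/-- The values of a merged triple. -/
structure IsMerge (c : X → ι) (B : Finset ι) (t u v : Triple X) : Prop where
  left : ∀ x, c x ∈ B → v.1 x = t.1 x ∧ v.2.1 x = t.2.1 x ∧ v.2.2 x = t.2.2 x
  right : ∀ x, c x ∉ B → v.1 x = u.1 x ∧ v.2.1 x = u.2.1 x ∧ v.2.2 x = u.2.2 x

theorem isMerge_merge (ht : IsColored c π S B t) (hu : IsColored c π S (s \ B) u) :
    IsMerge c B t u (t.merge u) := by
  have hd : ∀ x, c x ∈ B → ¬ c x ∈ s \ B := fun x hx h => (Finset.mem_sdiff.1 h).2 hx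
  refine ⟨fun x hx => ⟨?_, ?_, ?_⟩, fun x hx => ⟨?_, ?_, ?_⟩⟩
  · exact (Equiv.Perm.mul_apply_of_fixed hd ht.fix₁ hu.fix₁ x).1 hx
  · exact (Equiv.Perm.mul_apply_of_fixed hd ht.fix₂ hu.fix₂ x).1 hx
  · change t.2.2 x + u.2.2 x = _
    rw [hu.zero x (hd x hx), add_zero]
  · exact (Equiv.Perm.mul_apply_of_fixed hd ht.fix₁ hu.fix₁ x).2 hx
  · exact (Equiv.Perm.mul_apply_of_fixed hd ht.fix₂ hu.fix₂ x).2 hx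
  · change t.2.2 x + u.2.2 x = _
    rw [ht.zero x hx, zero_add]

variable {v : Triple X}

/-- Over `B` the triples `v` and `t` agree; points outside `B` stay outside `B`, so they impose no
condition on `C ⊆ B`. -/
theorem IsMerge.isStableOn_iff (h : IsMerge c B t u v) (ht : IsStableOn c B t)
    (hu : IsStableOn c B u) {C : Finset ι} (hC : C ⊆ B) :
    IsStableOn c C v ↔ IsStableOn c C t := by
  have hn : ∀ (w : Triple X) (x : X), IsStableOn c B w → c x ∉ B →
      (c (w.1 x) ∈ C ↔ c x ∈ C) ∧ (c (w.2.1 x) ∈ C ↔ c x ∈ C) := fun w x hw hx =>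
    have h0 : c x ∉ C := fun h => hx (hC h)
    ⟨iff_of_false (fun h => hx ((hw x).1.1 (hC h))) h0,
      iff_of_false (fun h => hx ((hw x).2.1 (hC h))) h0⟩
  constructor <;> intro h' x <;> by_cases hx : c x ∈ B
  · rw [← (h.left x hx).1, ← (h.left x hx).2.1]
    exact h' x
  · exact hn t x ht hx
  · rw [(h.left x hx).1, (h.left x hx).2.1]
    exact h' x
  · rw [(h.right x hx).1, (h.right x hx).2.1]
    exact hn u x hu hx

theorem IsColored.isStableOn_compl (hu : IsColored c π S (s \ B) u) : IsStableOn c B u := by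
  have h : ∀ {σ : Equiv.Perm X}, (∀ x, c x ∉ s \ B → σ x = x) → ∀ x, c (σ x) ∈ B ↔ c x ∈ B := by
    intro σ hσ x
    by_cases hx : c x ∈ s \ B
    · have h1 := (Equiv.Perm.mem_iff_of_fixed (p := fun x => c x ∈ s \ B) σ hσ x).2 hx
      exact iff_of_false (Finset.mem_sdiff.1 h1).2 (Finset.mem_sdiff.1 hx).2
    · rw [hσ x hx]
  exact fun x => ⟨h hu.fix₁ x, h hu.fix₂ x⟩

theorem IsMerge.isColored (h : IsMerge c B t u v) (hBs : B ⊆ s) (ht : IsColored c π S B t)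
    (hu : IsColored c π S (s \ B) u) : IsColored c π S s v := by
  have htB := ht.isStableOn
  have huB := hu.isStableOn_compl
  have hns : ∀ {x}, c x ∉ s → c x ∉ B ∧ c x ∉ s \ B := fun hx =>
    ⟨fun h => hx (hBs h), fun h => hx (Finset.sdiff_subset h)⟩
  refine ⟨fun x hx => ?_, fun x hx => ?_, fun x hx => ?_, fun x hx => ?_, fun x hx => ?_,
    fun x => ?_, fun x => ?_⟩
  · rw [(h.right x (hns hx).1).1, hu.fix₁ x (hns hx).2]
  · rw [(h.right x (hns hx).1).2.1, hu.fix₂ x (hns hx).2]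
  · by_cases hxB : c x ∈ B
    · rw [(h.left x hxB).2.1, (h.left _ ((htB x).2.2 hxB)).1, ht.mul x hxB]
    · rw [(h.right x hxB).2.1, (h.right _ (fun h => hxB ((huB x).2.1 h))).1,
        hu.mul x (Finset.mem_sdiff.2 ⟨hx, hxB⟩)]
  · by_cases hxB : c x ∈ B
    · rw [(h.left x hxB).2.2]
      exact ht.mem x hxB
    · rw [(h.right x hxB).2.2]
      exact hu.mem x (Finset.mem_sdiff.2 ⟨hx, hxB⟩)
  · rw [(h.right x (hns hx).1).2.2, hu.zero x (hns hx).2]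
  · by_cases hxB : c x ∈ B
    · rw [(h.left x hxB).2.2, (h.left x hxB).1, (h.left _ ((htB x).1.2 hxB)).2.2, ht.col]
    · rw [(h.right x hxB).2.2, (h.right x hxB).1,
        (h.right _ (fun h => hxB ((huB x).1.1 h))).2.2, hu.col]
  · by_cases hxB : c x ∈ B
    · rw [(h.left x hxB).2.2, (h.left x hxB).2.1, (h.left _ ((htB x).2.2 hxB)).2.2, ht.row]
    · rw [(h.right x hxB).2.2, (h.right x hxB).2.1,
        (h.right _ (fun h => hxB ((huB x).2.1 h))).2.2, hu.row]

theorem IsMerge.isConnectedOn_iff (h : IsMerge c B t u v) (ht : IsStableOn c B t)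
    (hu : IsStableOn c B u) : IsConnectedOn c B v ↔ IsConnectedOn c B t :=
  forall_congr' fun _ => forall_congr' fun hC => forall_congr' fun _ =>
    imp_congr_left (h.isStableOn_iff ht hu hC)

theorem IsMerge.right_unique (h : IsMerge c B t u v) {w : Triple X} (h' : IsMerge c B t u w) :
    v = w := by
  refine Prod.ext (Equiv.ext fun x => ?_) (Prod.ext (Equiv.ext fun x => ?_) (funext fun x => ?_)) <;>
    by_cases hx : c x ∈ B
  · rw [(h.left x hx).1, (h'.left x hx).1]
  · rw [(h.right x hx).1, (h'.right x hx).1]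
  · rw [(h.left x hx).2.1, (h'.left x hx).2.1]
  · rw [(h.right x hx).2.1, (h'.right x hx).2.1]
  · rw [(h.left x hx).2.2, (h'.left x hx).2.2]
  · rw [(h.right x hx).2.2, (h'.right x hx).2.2]

/-- Off `s` a triple is normalized to identity permutations and the box value `0`, so triples for
different label sets live in one type without being counted twice. -/
theorem IsColored.eq_of_eqOn {t' : Triple X} (h : IsColored c π S s t)
    (h' : IsColored c π S s t')
    (heq : ∀ x, c x ∈ s → t.1 x = t'.1 x ∧ t.2.1 x = t'.2.1 x ∧ t.2.2 x = t'.2.2 x) :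
    t = t' := by
  refine Prod.ext (Equiv.ext fun x => ?_) (Prod.ext (Equiv.ext fun x => ?_) (funext fun x => ?_)) <;>
    by_cases hx : c x ∈ s
  · exact (heq x hx).1
  · rw [h.fix₁ x hx, h'.fix₁ x hx]
  · exact (heq x hx).2.1
  · rw [h.fix₂ x hx, h'.fix₂ x hx]
  · exact (heq x hx).2.2
  · rw [h.zero x hx, h'.zero x hx]

theorem IsColored.exists_restrict (hv : IsColored c π S s v) (hBs : B ⊆ s)
    (hB : IsStableOn c B v) : ∃ t, IsColored c π S B t ∧
      ∀ x, c x ∈ B → t.1 x = v.1 x ∧ t.2.1 x = v.2.1 x ∧ t.2.2 x = v.2.2 x := by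
  obtain ⟨σ₁, h₁, h₁'⟩ := Equiv.Perm.exists_restrict (p := fun x => c x ∈ B) v.1 fun x => (hB x).1
  obtain ⟨σ₂, h₂, h₂'⟩ := Equiv.Perm.exists_restrict (p := fun x => c x ∈ B) v.2.1 fun x => (hB x).2
  refine ⟨(σ₁, σ₂, fun x => if c x ∈ B then v.2.2 x else 0),
    ⟨h₁', h₂', fun x hx => ?_, fun x hx => ?_, fun x hx => ?_, fun x => ?_, fun x => ?_⟩,
    fun x hx => ⟨h₁ x hx, h₂ x hx, if_pos hx⟩⟩
  · simp only
    rw [h₂ x hx, h₁ _ ((hB x).2.2 hx), hv.mul x (hBs hx)]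
  · simp only [if_pos hx]
    exact hv.mem x (hBs hx)
  · simp only [if_neg hx]
  · by_cases hx : c x ∈ B
    · simp only [h₁ x hx, (hB x).1.2 hx, hx, if_true, hv.col]
    · simp only [h₁' x hx]
  · by_cases hx : c x ∈ B
    · simp only [h₂ x hx, (hB x).2.2 hx, hx, if_true, hv.row]
    · simp only [h₂' x hx]

theorem IsStableOn.sdiff (hs : IsStableOn c s v) (hB : IsStableOn c B v) :
    IsStableOn c (s \ B) v := fun x => by
  simp [(hs x).1, (hs x).2, (hB x).1, (hB x).2]

theorem IsColored.exists_isMerge (hv : IsColored c π S s v) (hBs : B ⊆ s)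
    (hB : IsStableOn c B v) : ∃ t u, IsColored c π S B t ∧ IsColored c π S (s \ B) u ∧
      IsMerge c B t u v := by
  obtain ⟨t, ht, htv⟩ := hv.exists_restrict hBs hB
  obtain ⟨u, hu, huv⟩ := hv.exists_restrict Finset.sdiff_subset (hv.isStableOn.sdiff hB)
  refine ⟨t, u, ht, hu, fun x hx => ?_, fun x hx => ?_⟩
  · rw [(htv x hx).1, (htv x hx).2.1, (htv x hx).2.2]
    exact ⟨rfl, rfl, rfl⟩
  · by_cases hxs : c x ∈ s
    · have := huv x (Finset.mem_sdiff.2 ⟨hxs, hx⟩)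
      rw [this.1, this.2.1, this.2.2]
      exact ⟨rfl, rfl, rfl⟩
    · have hn : c x ∉ s \ B := fun h => hxs (Finset.sdiff_subset h)
      rw [hv.fix₁ x hxs, hv.fix₂ x hxs, hv.zero x hxs, hu.fix₁ x hn, hu.fix₂ x hn, hu.zero x hn]
      exact ⟨rfl, rfl, rfl⟩

end Merge

/-! ### Counting triples by the component of a marked label -/

section Recursion

variable [Fintype X] [DecidableEq X]

open Classical in
/-- The finite set of triples living on the points with label in `s`. -/
noncomputable def coloredTriples (c : X → ι) (π : Equiv.Perm X) (S : Finset (ℕ × ℕ))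
    (s : Finset ι) : Finset (Triple X) :=
  -- The value `0` is admitted for the points with label outside `s`; on the others the filter still
  -- demands a value in `S`.
  (Finset.univ ×ˢ Finset.univ ×ˢ Fintype.piFinset fun _ : X => insert 0 S).filter
    (IsColored c π S s)

theorem mem_coloredTriples : t ∈ coloredTriples c π S s ↔ IsColored c π S s t := by
  classical
  rw [coloredTriples, Finset.mem_filter, and_iff_right_of_imp]
  intro h
  simp only [Finset.mem_product, Finset.mem_univ, true_and, Fintype.mem_piFinset,
    Finset.mem_insert]
  intro x
  by_cases hx : c x ∈ s
  · exact Or.inr (h.mem x hx)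
  · exact Or.inl (h.zero x hx)

/-- The signed number of triples living on the points with label in `s`. -/
noncomputable def signedCount (c : X → ι) (π : Equiv.Perm X) (S : Finset (ℕ × ℕ))
    (s : Finset ι) : ℂ :=
  ∑ t ∈ coloredTriples c π S s, ((Equiv.Perm.sign t.1 : ℤ) : ℂ)

open Classical in
/-- The signed number of connected triples living on the points with label in `s`. -/
noncomputable def connectedSignedCount (c : X → ι) (π : Equiv.Perm X) (S : Finset (ℕ × ℕ))
    (s : Finset ι) : ℂ :=
  ∑ t ∈ coloredTriples c π S s with IsConnectedOn c s t, ((Equiv.Perm.sign t.1 : ℤ) : ℂ)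

open Classical in
-- Merging is a bijection from pairs of triples over `B` and `s \ B` to triples over `s` that
-- stabilize `B`. It multiplies signs and leaves connectedness on `B` unchanged.
theorem connectedSignedCount_mul_signedCount (hBs : B ⊆ s) :
    connectedSignedCount c π S B * signedCount c π S (s \ B)
      = ∑ v ∈ coloredTriples c π S s with IsStableOn c B v ∧ IsConnectedOn c B v,
          ((Equiv.Perm.sign v.1 : ℤ) : ℂ) := by
  rw [connectedSignedCount, signedCount, Finset.sum_mul_sum, ← Finset.sum_product']
  have hmem : ∀ p : Triple X × Triple X,
      p ∈ (coloredTriples c π S B).filter (IsConnectedOn c B) ×ˢ coloredTriples c π S (s \ B) ↔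
        (IsColored c π S B p.1 ∧ IsConnectedOn c B p.1) ∧ IsColored c π S (s \ B) p.2 := by
    intro p
    rw [Finset.mem_product, Finset.mem_filter, mem_coloredTriples, mem_coloredTriples]
  refine Finset.sum_bij (fun p _ => p.1.merge p.2) ?_ ?_ ?_ ?_
  · rintro ⟨t, u⟩ hp
    obtain ⟨⟨ht, hc⟩, hu⟩ := (hmem _).1 hp
    have hm := isMerge_merge ht hu
    rw [Finset.mem_filter, mem_coloredTriples]
    exact ⟨hm.isColored hBs ht hu,
      (hm.isStableOn_iff ht.isStableOn hu.isStableOn_compl subset_rfl).2 ht.isStableOn,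
      (hm.isConnectedOn_iff ht.isStableOn hu.isStableOn_compl).2 hc⟩
  · rintro ⟨t, u⟩ hp ⟨t', u'⟩ hp' h
    obtain ⟨⟨ht, -⟩, hu⟩ := (hmem _).1 hp
    obtain ⟨⟨ht', -⟩, hu'⟩ := (hmem _).1 hp'
    have hm := isMerge_merge ht hu
    have hm' := isMerge_merge ht' hu'
    simp only at h hm hm' ht hu ht' hu'
    rw [← h] at hm'
    refine Prod.ext (ht.eq_of_eqOn ht' fun x hx => ?_) (hu.eq_of_eqOn hu' fun x hx => ?_)
    · have h1 := hm.left x hx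
      have h2 := hm'.left x hx
      exact ⟨h1.1.symm.trans h2.1, h1.2.1.symm.trans h2.2.1, h1.2.2.symm.trans h2.2.2⟩
    · have h1 := hm.right x (Finset.mem_sdiff.1 hx).2
      have h2 := hm'.right x (Finset.mem_sdiff.1 hx).2
      exact ⟨h1.1.symm.trans h2.1, h1.2.1.symm.trans h2.2.1, h1.2.2.symm.trans h2.2.2⟩
  · intro v hv
    rw [Finset.mem_filter, mem_coloredTriples] at hv
    obtain ⟨hv, hst, hc⟩ := hv
    obtain ⟨t, u, ht, hu, hm⟩ := hv.exists_isMerge hBs hst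
    exact ⟨(t, u), (hmem _).2 ⟨⟨ht, (hm.isConnectedOn_iff ht.isStableOn
      hu.isStableOn_compl).1 hc⟩, hu⟩, (isMerge_merge ht hu).right_unique hm⟩
  · rintro ⟨t, u⟩ _
    simp [Triple.merge]

/-- Each triple is counted for exactly one `B`, the component of `a`. -/
theorem signedCount_eq_sum {a : ι} (ha : a ∈ s) :
    signedCount c π S s = ∑ B ∈ s.powerset with a ∈ B,
      connectedSignedCount c π S B * signedCount c π S (s \ B) := by
  classical
  have h1 : ∀ B ∈ s.powerset.filter (a ∈ ·),
      connectedSignedCount c π S B * signedCount c π S (s \ B)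
        = ∑ v ∈ coloredTriples c π S s, if IsStableOn c B v ∧ IsConnectedOn c B v then
          ((Equiv.Perm.sign v.1 : ℤ) : ℂ) else 0 := fun B hB => by
    rw [connectedSignedCount_mul_signedCount (Finset.mem_powerset.1 (Finset.mem_filter.1 hB).1),
      Finset.sum_filter]
  rw [Finset.sum_congr rfl h1, Finset.sum_comm, signedCount]
  refine Finset.sum_congr rfl fun v hv => ?_
  obtain ⟨B, ⟨hB, hB'⟩, huniq⟩ := existsUnique_component (mem_coloredTriples.1 hv).isStableOn ha
  rw [Finset.sum_eq_single_of_mem B hB fun C hC hne => if_neg fun h => hne (huniq C ⟨hC, h⟩),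
    if_pos hB']

end Recursion

end Splitting

/-! ### The moments as signed counts -/

section Moments

variable {X ι : Type*} [Fintype X] [DecidableEq X] [DecidableEq ι] {c : X → ι}
  {π : Equiv.Perm X} {S : Finset (ℕ × ℕ)} {s : Finset ι}

open Classical in
-- Extending the permutations by the identity and the function by `0` is a sign-preserving
-- bijection. It passes from the subtypes of the moment formula to triples on all of `X`.
theorem sum_sign_adapted_eq_signedCount [Fintype {x // c x ∈ s}]
    (ρ : Equiv.Perm {x // c x ∈ s}) (hρ : ∀ y, (ρ y : X) = π y) :
    ∑ f ∈ Fintype.piFinset fun _ : {x // c x ∈ s} => S,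
        ∑ σ : Equiv.Perm {x // c x ∈ s} × Equiv.Perm {x // c x ∈ s} with
          σ.1 * σ.2 = ρ ∧ Adapted σ f, ((Equiv.Perm.sign σ.1 : ℤ) : ℂ)
      = signedCount c π S s := by
  rw [Finset.sum_sigma', signedCount]
  let F : ({x // c x ∈ s} → ℕ × ℕ) → X → ℕ × ℕ := fun f x => if h : c x ∈ s then f ⟨x, h⟩ else 0
  have hF : ∀ f (y : {x // c x ∈ s}), F f y = f y := fun f y => dif_pos y.2
  have hF' : ∀ f x, c x ∉ s → F f x = 0 := fun f x hx => dif_neg hx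
  have hof : ∀ (σ : Equiv.Perm {x // c x ∈ s}) (y : {x // c x ∈ s}),
      Equiv.Perm.ofSubtype σ (y : X) = σ y := Equiv.Perm.ofSubtype_apply_coe
  have hof' : ∀ (σ : Equiv.Perm {x // c x ∈ s}) x, c x ∉ s → Equiv.Perm.ofSubtype σ x = x :=
    fun σ x hx => Equiv.Perm.ofSubtype_apply_of_not_mem σ hx
  refine Finset.sum_bij
    (fun p _ => (Equiv.Perm.ofSubtype p.2.1, Equiv.Perm.ofSubtype p.2.2, F p.1)) ?_ ?_ ?_ ?_
  · rintro ⟨f, σ₁, σ₂⟩ h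
    simp only [Finset.mem_sigma, Fintype.mem_piFinset, Finset.mem_filter, Finset.mem_univ,
      true_and] at h
    obtain ⟨hf, hm, hcol, hrow⟩ := h
    rw [mem_coloredTriples]
    refine ⟨hof' σ₁, hof' σ₂, fun x hx => ?_, fun x hx => ?_, hF' f, fun x => ?_, fun x => ?_⟩
    · lift x to {x // c x ∈ s} using hx
      simp only [hof]
      rw [← hρ, ← hm, Equiv.Perm.mul_apply]
    · lift x to {x // c x ∈ s} using hx
      simp only [hF]
      exact hf x
    · by_cases hx : c x ∈ s
      · lift x to {x // c x ∈ s} using hx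
        simp only [hof, hF]
        exact hcol x
      · simp only [hof' _ x hx]
    · by_cases hx : c x ∈ s
      · lift x to {x // c x ∈ s} using hx
        simp only [hof, hF]
        exact hrow x
      · simp only [hof' _ x hx]
  · rintro ⟨f, σ₁, σ₂⟩ _ ⟨f', σ₁', σ₂'⟩ _ h
    simp only [Prod.mk.injEq] at h
    have h1 := Equiv.Perm.ofSubtype_injective h.1
    have h2 := Equiv.Perm.ofSubtype_injective h.2.1
    have h3 : f = f' := by
      ext1 y
      rw [← hF f, h.2.2, hF]
    rw [h1, h2, h3]
  · rintro ⟨σ₁, σ₂, f⟩ h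
    rw [mem_coloredTriples] at h
    have hst := h.isStableOn
    refine ⟨⟨fun y => f y, σ₁.subtypePerm fun x => (hst x).1, σ₂.subtypePerm fun x => (hst x).2⟩,
      ?_, ?_⟩
    · simp only [Finset.mem_sigma, Fintype.mem_piFinset, Finset.mem_filter, Finset.mem_univ,
        true_and]
      refine ⟨fun y => h.mem y y.2, ?_, fun y => h.col y, fun y => h.row y⟩
      ext1 y
      apply Subtype.ext
      rw [hρ]
      exact h.mul y y.2
    · refine Prod.ext ?_ (Prod.ext ?_ ?_)
      · exact Equiv.Perm.ofSubtype_subtypePerm (fun x => (hst x).1)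
          fun x hx => not_imp_comm.1 (h.fix₁ x) hx
      · exact Equiv.Perm.ofSubtype_subtypePerm (fun x => (hst x).2)
          fun x hx => not_imp_comm.1 (h.fix₂ x) hx
      · ext1 x
        by_cases hx : c x ∈ s
        · exact hF _ ⟨x, hx⟩
        · exact (hF' _ x hx).trans (h.zero x hx).symm
  · rintro ⟨f, σ₁, σ₂⟩ _
    simp

end Moments

/-! ### Disjoint cumulants as connected signed counts -/

section Blocks

variable {n : ℕ} {lam : YoungDiagram} (T : Fin n ≃ lam.cells)

theorem charExpectation_prod_conjClassSum {ι : Type*} [Fintype ι] [DecidableEq ι] {l : ι → ℕ}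
    (π : (i : ι) → Equiv.Perm (Fin (l i))) (s : Finset ι) :
    charExpectation (youngRep T) (∏ i ∈ s, conjClassSum n (π i))
      = signedCount Sigma.fst (Equiv.Perm.sigmaCongrRight π) lam.cells s := by
  rw [prod_conjClassSum, charExpectation_classSum,
    ← sum_sign_adapted_eq_signedCount (blockPerm π s) fun _ => rfl]

theorem charExpectation_one : charExpectation (youngRep T) 1 = 1 := by
  have : (1 : DisjointAlgebra (Fin n)) = DisjointAlgebra.of (PartialPermutation.empty _) := rfl
  rw [this, charExpectation, DisjointAlgebra.lift_of]
  exact div_self (trace_youngRep_one_ne_zero T)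

theorem disjointCumulant_youngRep {r : ℕ} (hr : 1 ≤ r) (l : Fin r → ℕ)
    (π : (i : Fin r) → Equiv.Perm (Fin (l i))) :
    disjointCumulant (youngRep T) l π
      = connectedSignedCount Sigma.fst (Equiv.Perm.sigmaCongrRight π) lam.cells Finset.univ := by
  refine jointCumulant_eq_of_recursion _ _ (charExpectation_one T)
    (connectedSignedCount Sigma.fst (Equiv.Perm.sigmaCongrRight π) lam.cells) (fun s a ha => ?_)
    Finset.univ ⟨⟨0, hr⟩, Finset.mem_univ _⟩
  simp only [charExpectation_prod_conjClassSum]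
  exact signedCount_eq_sum ha

end Blocks

/-! ### Signs, colorings and transitivity -/

theorem sign_eq_neg_one_pow_reflectionLength {X : Type*} [Fintype X] [DecidableEq X]
    (σ : Equiv.Perm X) :
    ((Equiv.Perm.sign σ : ℤ) : ℂ) = (-1) ^ reflectionLength σ := by
  have hne : {k | ∃ L : List (Equiv.Perm X), L.length = k ∧ (∀ τ ∈ L, τ.IsSwap) ∧
      L.prod = σ}.Nonempty := by
    obtain ⟨L, hL⟩ := (Equiv.Perm.truncSwapFactors σ).out
    exact ⟨L.length, L, rfl, hL.2, hL.1⟩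
  obtain ⟨L, hlen, hswap, hprod⟩ := Nat.sInf_mem hne
  rw [reflectionLength, ← hlen, ← hprod, Equiv.Perm.sign_prod_list_swap hswap]
  simp

theorem Equiv.Perm.SameCycle.apply_eq_of_invariant {X β : Type*} {σ : Equiv.Perm X} {k : X → β}
    (hk : ∀ x, k (σ x) = k x) {x y : X} (h : σ.SameCycle x y) : k x = k y := by
  obtain ⟨i, rfl⟩ := h
  induction i using Int.induction_on with
  | zero => simp
  | succ i ih =>
    rw [ih, add_comm, zpow_add, zpow_one, Equiv.Perm.mul_apply, hk]
  | pred i ih =>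
    rw [ih, ← hk ((σ ^ (-(i : ℤ) - 1)) x), ← Equiv.Perm.mul_apply, ← zpow_one_add]
    simp

open Classical in
-- A coloring `h` corresponds to the function sending `x` to the box whose row is the color of its
-- `σ₂`-cycle and whose column is the color of its `σ₁`-cycle. Two cycles intersect exactly when
-- they share some `x`, so compatibility says that all these boxes lie in `λ`.
theorem colorings_eq_card {X : Type*} [Fintype X] (lam : YoungDiagram) (σ₁ σ₂ : Equiv.Perm X) :
    colorings lam σ₁ σ₂
      = ((Fintype.piFinset fun _ : X => lam.cells).filter (Adapted (σ₁, σ₂))).card := by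
  rw [colorings, ← Nat.card_eq_finsetCard]
  have hinl : ∀ f : X → ℕ × ℕ, Adapted (σ₁, σ₂) f → ∀ x y, (Equiv.Perm.SameCycle.setoid σ₁) x y →
      (f x).2 = (f y).2 := fun f hf x y h =>
    Equiv.Perm.SameCycle.apply_eq_of_invariant (k := fun x => (f x).2) hf.1 h
  have hinr : ∀ f : X → ℕ × ℕ, Adapted (σ₁, σ₂) f → ∀ x y, (Equiv.Perm.SameCycle.setoid σ₂) x y →
      (f x).1 = (f y).1 := fun f hf x y h =>
    Equiv.Perm.SameCycle.apply_eq_of_invariant (k := fun x => (f x).1) hf.2 h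
  have hmem : ∀ f, f ∈ (Fintype.piFinset fun _ : X => lam.cells).filter (Adapted (σ₁, σ₂)) ↔
      (∀ x, f x ∈ lam) ∧ Adapted (σ₁, σ₂) f := fun f => by
    simp [Fintype.mem_piFinset]
  refine Nat.card_congr
    { toFun := fun h => ⟨fun x => (h.1 (Sum.inr (Quotient.mk _ x)), h.1 (Sum.inl (Quotient.mk _ x))),
        (hmem _).2 ⟨fun x => h.2 _ _ ⟨x, rfl, rfl⟩, fun x => ?_, fun x => ?_⟩⟩
      invFun := fun f => ⟨Sum.elim
          (Quotient.lift (fun x => (f.1 x).2) (hinl f.1 ((hmem _).1 f.2).2))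
          (Quotient.lift (fun x => (f.1 x).1) (hinr f.1 ((hmem _).1 f.2).2)), ?_⟩
      left_inv := fun h => ?_
      right_inv := fun f => rfl }
  · refine congrArg (fun q => h.1 (Sum.inl q)) (Quotient.sound ?_)
    exact Equiv.Perm.sameCycle_apply_left.2 (Equiv.Perm.SameCycle.refl _ _)
  · refine congrArg (fun q => h.1 (Sum.inr q)) (Quotient.sound ?_)
    exact Equiv.Perm.sameCycle_apply_left.2 (Equiv.Perm.SameCycle.refl _ _)
  · rintro _ _ ⟨x, rfl, rfl⟩
    exact ((hmem _).1 f.2).1 x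
  · apply Subtype.ext
    ext1 (q | q) <;> induction q using Quotient.inductionOn <;> rfl

/-- The block group is transitive on each block, so orbits are unions of blocks and correspond to
stable sets of labels. Blocks must be nonempty: the label of an empty block would be stable by
itself, unseen by the action. -/
theorem actTransitively_iff {r : ℕ} {l : Fin r → ℕ} (hl : ∀ i, 1 ≤ l i)
    (t : Triple (Σ i, Fin (l i))) :
    ActTransitively l t.1 t.2.1 ↔ IsConnectedOn Sigma.fst Finset.univ t := by
  classical
  set G := Subgroup.closure ({t.1, t.2.1} ∪
    Set.range (Equiv.Perm.sigmaCongrRightHom fun i => Fin (l i))) with hG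
  constructor
  · intro h C _ ⟨j, hj⟩ hC
    have key : ∀ g ∈ G, ∀ x : Σ i, Fin (l i), (g x).1 ∈ C ↔ x.1 ∈ C := by
      intro g hg
      induction hg using Subgroup.closure_induction with
      | mem g hg =>
        rcases hg with (rfl | rfl) | ⟨p, rfl⟩
        · exact fun x => (hC x).1
        · exact fun x => (hC x).2
        · exact fun x => Iff.rfl
      | one => exact fun x => Iff.rfl
      | mul g h _ _ ihg ihh => exact fun x => (ihg (h x)).trans (ihh x)
      | inv g _ ih => exact fun x => by rw [← ih (g⁻¹ x)]; simp
    refine Finset.eq_univ_of_forall fun i => ?_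
    obtain ⟨g, hg⟩ := h.exists_smul_eq ⟨j, ⟨0, hl j⟩⟩ ⟨i, ⟨0, hl i⟩⟩
    have := key g.1 g.2 ⟨j, ⟨0, hl j⟩⟩
    have hg' : g.1 ⟨j, ⟨0, hl j⟩⟩ = ⟨i, ⟨0, hl i⟩⟩ := hg
    rw [hg'] at this
    exact this.2 hj
  · intro h
    refine ⟨fun x y => ?_⟩
    -- The labels met by the orbit of `x`; by `hC` the orbit is everything with such a label.
    let C : Finset (Fin r) := Finset.univ.filter fun i => ∃ g ∈ G, (g x).1 = i
    have h1 : t.1 ∈ G := Subgroup.subset_closure (by simp)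
    have h2 : t.2.1 ∈ G := Subgroup.subset_closure (by simp)
    have hblock : ∀ (i : Fin r) (a b : Fin (l i)), ∃ p ∈ G, p ⟨i, a⟩ = ⟨i, b⟩ := fun i a b =>
      ⟨Equiv.Perm.sigmaCongrRightHom (fun i => Fin (l i))
        (Function.update (fun _ => 1) i (Equiv.swap a b)),
        Subgroup.subset_closure (Or.inr ⟨_, rfl⟩), by simp⟩
    have hC : ∀ z, z.1 ∈ C ↔ ∃ g ∈ G, g x = z := by
      rintro ⟨i, b⟩
      simp only [C, Finset.mem_filter, Finset.mem_univ, true_and]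
      constructor
      · rintro ⟨g, hg, rfl⟩
        obtain ⟨p, hp, hpb⟩ := hblock (g x).1 (g x).2 b
        exact ⟨p * g, G.mul_mem hp hg, hpb⟩
      · rintro ⟨g, hg, hgx⟩
        exact ⟨g, hg, by rw [hgx]⟩
    have hst : ∀ τ ∈ G, ∀ z : Σ i, Fin (l i), (τ z).1 ∈ C ↔ z.1 ∈ C := by
      intro τ hτ z
      rw [hC, hC]
      constructor
      · rintro ⟨g, hg, hgz⟩
        exact ⟨τ⁻¹ * g, G.mul_mem (G.inv_mem hτ) hg, by simp [hgz]⟩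
      · rintro ⟨g, hg, rfl⟩
        exact ⟨τ * g, G.mul_mem hτ hg, rfl⟩
    have hCu := h C (Finset.subset_univ _) ⟨x.1, (hC x).2 ⟨1, G.one_mem, rfl⟩⟩
      fun z => ⟨hst _ h1 z, hst _ h2 z⟩
    obtain ⟨g, hg, hgy⟩ := (hC y).1 (hCu ▸ Finset.mem_univ _)
    exact ⟨⟨g, hg⟩, hgy⟩

open Classical in
theorem mainTheorem12 {n : ℕ} (lam : YoungDiagram) (T : Fin n ≃ lam.cells)
    {r : ℕ} (hr : 1 ≤ r) (l : Fin r → ℕ) (hl : ∀ i, 1 ≤ l i)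
    (π : (i : Fin r) → Equiv.Perm (Fin (l i))) :
    disjointCumulant (youngRep T) l π =
      ∑ σ : Equiv.Perm (Σ i, Fin (l i)) × Equiv.Perm (Σ i, Fin (l i)) with
          σ.1 * σ.2 = Equiv.Perm.sigmaCongrRight π ∧ ActTransitively l σ.1 σ.2,
        (-1 : ℂ) ^ reflectionLength σ.1 * (colorings lam σ.1 σ.2 : ℂ) := by
  rw [disjointCumulant_youngRep T hr]
  have h : ∀ σ : Equiv.Perm (Σ i, Fin (l i)) × Equiv.Perm (Σ i, Fin (l i)),
      (-1 : ℂ) ^ reflectionLength σ.1 * (colorings lam σ.1 σ.2 : ℂ)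
        = ∑ _f ∈ (Fintype.piFinset fun _ => lam.cells).filter (Adapted σ),
            ((Equiv.Perm.sign σ.1 : ℤ) : ℂ) := by
    intro σ
    rw [Finset.sum_const, nsmul_eq_mul, mul_comm, colorings_eq_card,
      sign_eq_neg_one_pow_reflectionLength]
    congr!
  rw [Finset.sum_congr rfl fun σ _ => h σ, Finset.sum_sigma', connectedSignedCount]
  -- With all labels present the normalization off the label set is void, so only the bracketing of
  -- the triple changes.
  refine Finset.sum_bij' (fun t _ => ⟨(t.1, t.2.1), t.2.2⟩) (fun p _ => (p.1.1, p.1.2, p.2))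
    ?_ ?_ (fun _ _ => rfl) (fun _ _ => rfl) (fun _ _ => rfl)
  · intro t ht
    rw [Finset.mem_filter, mem_coloredTriples, ← actTransitively_iff hl] at ht
    obtain ⟨hc, ht⟩ := ht
    simp only [Finset.mem_sigma, Finset.mem_filter, Finset.mem_univ, true_and,
      Fintype.mem_piFinset]
    exact ⟨⟨Equiv.ext fun x => hc.mul x (Finset.mem_univ _), ht⟩,
      fun x => hc.mem x (Finset.mem_univ _), hc.col, hc.row⟩
  · rintro ⟨⟨σ₁, σ₂⟩, f⟩ hp
    simp only [Finset.mem_sigma, Finset.mem_filter, Finset.mem_univ, true_and,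
      Fintype.mem_piFinset] at hp
    obtain ⟨⟨hm, ht⟩, hf, hcol, hrow⟩ := hp
    rw [Finset.mem_filter, mem_coloredTriples, ← actTransitively_iff hl]
    exact ⟨⟨by simp, by simp, fun x _ => DFunLike.congr_fun hm x, fun x _ => hf x, by simp,
      hcol, hrow⟩, ht⟩
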